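/- Let $n\ge 0$ be an integer, $\omega=e^{2\pi\sqrt{-1}/(n+1)}$, and number the rows and columns of $(n+1)\times(n+1)$ matrices by $0,\dots,n$. Let $E_{i,j}$ be the elementary matrices, let $\Pi=(\delta_{i+1,j})$ with $i+1$ read mod $n+1$, let $\hat\Pi=\mathrm{diag}(1,\dots,1,-1)\,\Pi$, let $C$ be the permutation matrix with entry $1$ exactly where $i+j\equiv 0 \bmod (n+1)$, and let $\tilde C=\mathrm{diag}(1,-1,\dots,-1)\,C$. Put $P=\hat\Pi$ if $n$ is odd and $P=\Pi$ if $n$ is even, so that $P\in \mathrm{SL}_{n+1}\mathbb C$. For $k\in\frac1{n+1}\mathbb Z$ put $\theta_k=-\frac{\pi}{n+1}-(k-1)\pi$ if $n$ is odd and $\theta_k=-\frac{\pi}{2(n+1)}-(k-1)\pi$ if $n$ is even. Let $\mathcal R_k$ be the set of pairs $(i,j)$, $i\neq j$, such that $\omega^j-\omega^i\in \mathbb R_{>0}\,e^{\sqrt{-1}\,\theta_k}$, and let $U_k\subset\mathrm{SL}_{n+1}\mathbb C$ be the group generated by the groups $\exp(\mathbb C E_{i,j})$, $(i,j)\in\mathcal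 R_k$. Let $$\mathcal M_{n+1}=U_1\,U_{1+\frac1{n+1}}\,P\subset \mathrm{SL}_{n+1}\mathbb C,\qquad \mathcal Z_{n+1}=\{(B,A)\mid B\in\mathrm{SL}_{n+1}\mathbb C,\ A\in\mathcal M_{n+1},\ BA=AB\}.$$ Each $A\in\mathcal M_{n+1}$ determines a unique family of matrices $\tilde Q_k\in\mathrm{SL}_{n+1}\mathbb C$, $k\in\frac1{n+1}\mathbb Z$ (its Stokes factors), such that $\tilde Q_1\in U_1$, $\tilde Q_{1+\frac1{n+1}}\in U_{1+\frac1{n+1}}$, $A=\tilde Q_1\tilde Q_{1+\frac1{n+1}}P$, and $\tilde Q_{k+\frac2{n+1}}=P\tilde Q_kP^{-1}$ for all $k$. Put $\tilde S_1=\tilde Q_1\tilde Q_{1+\frac1{n+1}}\cdots\tilde Q_{1+\frac n{n+1}}$ and $$F_\sigma(A)=\begin{cases}\hat\Pi^{(n+1)/2}& n \text{ odd}\\ (\tilde S_1)^T& n\text{ even}\end{cases}\qquad F_\theta(A)=\begin{cases}\overline{\tilde C\,\tilde Q_{\frac n{n+1}}}& n \text{ odd}\\ C& n\text{ even.}\end{cases}$$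 Write $\mathrm{Ad}_F X=FXF^{-1}$ and $X^{-T}=(X^{-1})^T$. Theorem. The formulas $$\sigma(B,A)=(\mathrm{Ad}_{F_\sigma(A)}B^{-T},\ \mathrm{Ad}_{F_\sigma(A)}A^{-T}),\qquad \theta(B,A)=(\mathrm{Ad}_{F_\theta(A)}\bar B,\ \mathrm{Ad}_{F_\theta(A)}\bar A^{-1})$$ define maps $\sigma,\theta:\mathcal Z_{n+1}\to\mathcal Z_{n+1}$, and these satisfy $\sigma\circ\sigma=\mathrm{id}$, $\theta\circ\theta=\mathrm{id}$ and $\sigma\circ\theta=\theta\circ\sigma$. -/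

import Mathlib

open Matrix

namespace TTStarToda

/-- `SL_{n+1} ℂ`. Rows and columns are numbered `0, …, n`. -/
abbrev SLC (n : ℕ) : Type := Matrix.SpecialLinearGroup (Fin (n + 1)) ℂ

/-- `GL_{n+1} ℂ`. -/
abbrev GLC (n : ℕ) : Type := GL (Fin (n + 1)) ℂ

/-! ### The matrices `Π`, `Π̂`, `C`, `C̃` -/

/-- `Π = (δ_{i,i+1})`, the index `i + 1` being taken mod `n + 1`. -/
def cyc (n : ℕ) : Matrix (Fin (n + 1)) (Fin (n + 1)) ℂ :=
  Matrix.of fun i j => if j = i + 1 then 1 else 0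

/-- `Π̂ = diag(1, …, 1, -1) Π`. -/
def cycHat (n : ℕ) : Matrix (Fin (n + 1)) (Fin (n + 1)) ℂ :=
  Matrix.diagonal (fun i => if i = Fin.last n then -1 else 1) * cyc n

/-- `C`: entry `1` at `(0,0)` and at `(i, n+1-i)` for `1 ≤ i ≤ n`, and `0` elsewhere;
that is, `1` exactly where `i + j ≡ 0 mod n + 1`. -/
def reflC (n : ℕ) : Matrix (Fin (n + 1)) (Fin (n + 1)) ℂ :=
  Matrix.of fun i j => if j = -i then 1 else 0

/-- `C̃ = diag(1, -1, …, -1) C`. -/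
def reflCTilde (n : ℕ) : Matrix (Fin (n + 1)) (Fin (n + 1)) ℂ :=
  Matrix.diagonal (fun i => if i = 0 then 1 else -1) * reflC n

theorem det_cyc (n : ℕ) : (cyc n).det = (-1) ^ n := by
  have h : cyc n = (finRotate (n + 1)).permMatrix ℂ := by
    ext i j
    simp [cyc, Equiv.Perm.permMatrix, PEquiv.toMatrix_apply, eq_comm]
  rw [h, Matrix.det_permutation, sign_finRotate]
  simp

theorem det_cycHat (n : ℕ) : (cycHat n).det = -(-1) ^ n := by
  rw [cycHat, Matrix.det_mul, Matrix.det_diagonal, det_cyc]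
  simp [Finset.prod_ite_eq']

theorem reflC_mul_self (n : ℕ) : reflC n * reflC n = 1 := by
  ext i j
  simp only [reflC, Matrix.mul_apply, Matrix.of_apply, Matrix.one_apply, ite_mul, one_mul,
    zero_mul, Finset.sum_ite_eq', Finset.mem_univ, if_true, neg_neg]
  exact if_congr eq_comm rfl rfl

theorem reflCTilde_mul_self (n : ℕ) : reflCTilde n * reflCTilde n = 1 := by
  have h : ∀ i j, reflCTilde n i j = if j = -i then (if i = 0 then 1 else -1) else 0 := by
    intro i j
    rw [reflCTilde, Matrix.diagonal_mul, reflC, Matrix.of_apply, mul_ite, mul_one, mul_zero]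
  ext i j
  simp only [Matrix.mul_apply, h, ite_mul, zero_mul, Finset.sum_ite_eq', Finset.mem_univ,
    if_true, neg_neg, neg_eq_zero, Matrix.one_apply]
  by_cases hi : i = 0 <;> by_cases hij : i = j <;> (simp [hi, hij, eq_comm]; try grind)

/-- `Π̂` if `n` is odd, `Π` if `n` is even. -/
def coxeter (n : ℕ) : SLC n :=
  ⟨if Odd n then cycHat n else cyc n, by
    split_ifs with h
    · rw [det_cycHat, h.neg_one_pow, neg_neg]
    · rw [det_cyc, (Nat.not_odd_iff_even.1 h).neg_one_pow]⟩

/-- `C` as an element of `GL_{n+1} ℂ`. -/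
def reflCGL (n : ℕ) : GLC n := ⟨reflC n, reflC n, reflC_mul_self n, reflC_mul_self n⟩

/-- `C̃` as an element of `GL_{n+1} ℂ`. -/
def reflCTildeGL (n : ℕ) : GLC n :=
  ⟨reflCTilde n, reflCTilde n, reflCTilde_mul_self n, reflCTilde_mul_self n⟩

/-! ### Singular directions, roots, and the space `𝓜_{n+1}` -/

/-- `ω = exp (2π√-1 / (n+1))`. -/
noncomputable def omega (n : ℕ) : ℂ :=
  Complex.exp (2 * Real.pi * Complex.I / ((n : ℂ) + 1))

/-- The angle `θ_k` of the `k`-th singular direction (used for `k ∈ (1/(n+1)) ℤ`). -/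
noncomputable def singularAngle (n : ℕ) (k : ℝ) : ℝ :=
  if Odd n then -(1 / ((n : ℝ) + 1)) * Real.pi - (k - 1) * Real.pi
  else -(1 / (2 * ((n : ℝ) + 1))) * Real.pi - (k - 1) * Real.pi

/-- The set `R_k` of roots `x_i - x_j` attached to the singular direction `θ_k`: those for
which `ω^j - ω^i` lies on the ray of angle `θ_k`, equivalently for which
`exp ((ω^i - ω^j)/ζ)` decays fastest as `ζ → 0` with `arg ζ = θ_k`. Those are the positions
at which the Stokes factor of `ψ ~ (⋯) exp (ζ⁻¹ diag(1, ω, …, ω^n))` may be nonzero. -/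
def rootSet (n : ℕ) (k : ℝ) : Set (Fin (n + 1) × Fin (n + 1)) :=
  {p | p.1 ≠ p.2 ∧ ∃ r : ℝ, 0 < r ∧
    omega n ^ (p.2 : ℕ) - omega n ^ (p.1 : ℕ)
      = (r : ℂ) * Complex.exp ((singularAngle n k : ℂ) * Complex.I)}

theorem omega_pow_sub (n a b : ℕ) :
    omega n ^ b - omega n ^ a = ((2 * Real.sin (Real.pi * ((b : ℝ) - a) / (n + 1)) : ℝ) : ℂ) *
      Complex.exp (((Real.pi * ((a : ℝ) + b) / (n + 1) + Real.pi / 2 : ℝ) : ℂ) * Complex.I) := by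
  have hn : (n : ℂ) + 1 ≠ 0 := by exact_mod_cast Nat.succ_ne_zero n
  have h1 : ∀ c : ℕ, omega n ^ c = Complex.exp (2 * Real.pi * c / ((n : ℂ) + 1) * Complex.I) := by
    intro c
    rw [omega, ← Complex.exp_nat_mul]
    congr 1
    field_simp
  have h2 : Complex.exp (((Real.pi * ((a : ℝ) + b) / (n + 1) + Real.pi / 2 : ℝ) : ℂ) * Complex.I)
      = Complex.exp (Real.pi * ((a : ℂ) + b) / (n + 1) * Complex.I) * Complex.I := by
    push_cast
    rw [add_mul, Complex.exp_add, Complex.exp_pi_div_two_mul_I]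
  rw [h1, h1, h2]
  push_cast
  rw [Complex.two_sin]
  have h3 : Complex.exp (2 * Real.pi * b / ((n : ℂ) + 1) * Complex.I) =
      Complex.exp (Real.pi * ((a : ℂ) + b) / (n + 1) * Complex.I) *
      Complex.exp (Real.pi * ((b : ℂ) - a) / (n + 1) * Complex.I) := by
    rw [← Complex.exp_add]; congr 1; field_simp; ring
  have h4 : Complex.exp (2 * Real.pi * a / ((n : ℂ) + 1) * Complex.I) =
      Complex.exp (Real.pi * ((a : ℂ) + b) / (n + 1) * Complex.I) *
      Complex.exp (-(Real.pi * ((b : ℂ) - a) / (n + 1)) * Complex.I) := by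
    rw [← Complex.exp_add]; congr 1; field_simp; ring
  rw [h3, h4]
  linear_combination (Complex.exp (Real.pi * ((a : ℂ) + b) / (n + 1) * Complex.I) *
      Complex.exp (Real.pi * ((b : ℂ) - a) / (n + 1) * Complex.I) -
      Complex.exp (Real.pi * ((a : ℂ) + b) / (n + 1) * Complex.I) *
      Complex.exp (-(Real.pi * ((b : ℂ) - a) / (n + 1)) * Complex.I)) * Complex.I_mul_I

theorem same_ray_iff (s φ θ : ℝ) (hs : 0 < s) :
    (∃ r : ℝ, 0 < r ∧ (s : ℂ) * Complex.exp ((φ : ℂ) * Complex.I)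
      = (r : ℂ) * Complex.exp ((θ : ℂ) * Complex.I)) ↔
    ∃ k : ℤ, φ = θ + k * (2 * Real.pi) := by
  constructor
  · rintro ⟨r, hr, h⟩
    have h1 := congrArg (fun z : ℂ => ‖z‖) h
    simp only [norm_mul, Complex.norm_exp_ofReal_mul_I, Complex.norm_real, mul_one,
      Real.norm_eq_abs, abs_of_pos hs, abs_of_pos hr] at h1
    subst h1
    have h2 := mul_left_cancel₀ (by exact_mod_cast hs.ne') h
    obtain ⟨k, hk⟩ := Complex.exp_eq_exp_iff_exists_int.1 h2
    refine ⟨k, ?_⟩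
    have h3 : (φ : ℂ) * Complex.I = ((θ : ℂ) + k * (2 * Real.pi)) * Complex.I := by
      rw [hk]; ring
    exact_mod_cast mul_right_cancel₀ Complex.I_ne_zero h3
  · rintro ⟨k, rfl⟩
    refine ⟨s, hs, ?_⟩
    congr 1
    refine Complex.exp_eq_exp_iff_exists_int.2 ⟨k, ?_⟩
    push_cast; ring

/-- `R_k` in terms of congruences, for `k = m/(n+1)`. -/
theorem mem_rootSet_iff (n : ℕ) (m : ℤ) (i j : Fin (n + 1)) :
    (i, j) ∈ rootSet n ((m : ℝ) / ((n : ℝ) + 1)) ↔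
      (i.val < j.val ∧ (2 * ((n : ℤ) + 1)) ∣
        i.val + j.val + m + (if Odd n then 1 else 0) - (n + 1) / 2) ∨
      (j.val < i.val ∧ (2 * ((n : ℤ) + 1)) ∣
        i.val + j.val + m + (if Odd n then 1 else 0) - (n + 1) / 2 - (n + 1)) := by
  have hN : (0 : ℝ) < (n : ℝ) + 1 := by positivity
  have hpi := Real.pi_pos
  have hsplit : (∃ l : ℕ, n = 2 * l ∧ ¬ Odd n ∧ ((n : ℤ) + 1) / 2 = l) ∨
      (∃ l : ℕ, n = 2 * l + 1 ∧ Odd n ∧ ((n : ℤ) + 1) / 2 = l + 1) := by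
    rcases Nat.even_or_odd' n with ⟨l, hl | hl⟩
    · exact Or.inl ⟨l, hl, by rw [Nat.not_odd_iff_even]; exact ⟨l, by omega⟩, by omega⟩
    · exact Or.inr ⟨l, hl, ⟨l, hl⟩, by omega⟩
  have key : ∀ (ε : ℤ), (∃ k : ℤ, Real.pi * ((i.val : ℝ) + j.val) / (n + 1) + Real.pi / 2 +
        ε * Real.pi = singularAngle n ((m : ℝ) / ((n : ℝ) + 1)) + k * (2 * Real.pi)) ↔
      (2 * ((n : ℤ) + 1)) ∣ i.val + j.val + m + (if Odd n then 1 else 0) - (n + 1) / 2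
        + ε * (n + 1) := by
    intro ε
    refine exists_congr fun k => ?_
    rw [← @Int.cast_inj ℝ]
    have hpos : Real.pi / ((n : ℝ) + 1) ≠ 0 := by positivity
    have haux : ∀ x y u v : ℝ, Real.pi / ((n : ℝ) + 1) ≠ 0 →
        x - y = Real.pi / ((n : ℝ) + 1) * (u - v) → (x = y ↔ u = v) := by
      intro x y u v h0 h
      rw [← sub_eq_zero, h, mul_eq_zero, or_iff_right h0, sub_eq_zero]
    rcases hsplit with ⟨l, hl, hodd, hdiv⟩ | ⟨l, hl, hodd, hdiv⟩
    · have hnl : (n : ℝ) = 2 * l := by exact_mod_cast hl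
      simp only [singularAngle, hodd, if_false, hdiv]
      push_cast
      refine haux _ _ _ _ hpos ?_
      field_simp
      rw [hnl]
      ring
    · have hnl : (n : ℝ) = 2 * l + 1 := by exact_mod_cast hl
      simp only [singularAngle, hodd, if_true, hdiv]
      push_cast
      refine haux _ _ _ _ hpos ?_
      field_simp
      rw [hnl]
      ring
  have hj : (j.val : ℝ) < n + 1 := by exact_mod_cast j.isLt
  have hi : (i.val : ℝ) < n + 1 := by exact_mod_cast i.isLt
  have hi0 : (0 : ℝ) ≤ i.val := Nat.cast_nonneg _
  have hj0 : (0 : ℝ) ≤ j.val := Nat.cast_nonneg _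
  rcases lt_trichotomy i.val j.val with h | h | h
  · have hne : i ≠ j := fun e => by simp [e] at h
    have hij : (i.val : ℝ) < j.val := by exact_mod_cast h
    have hs : 0 < 2 * Real.sin (Real.pi * ((j.val : ℝ) - i.val) / (n + 1)) := by
      refine mul_pos two_pos (Real.sin_pos_of_pos_of_lt_pi ?_ ?_)
      · exact div_pos (mul_pos hpi (by linarith)) hN
      · rw [div_lt_iff₀ hN]
        exact mul_lt_mul_of_pos_left (by linarith) hpi
    have hk := key 0
    simp only [Int.cast_zero, zero_mul, add_zero] at hk
    have hno : ¬ j.val < i.val := by omega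
    simp only [rootSet, Set.mem_ofPred_eq, ne_eq, hne, not_false_eq_true, true_and, h, hno,
      false_and, or_false]
    rw [← hk, ← same_ray_iff _ _ _ hs, omega_pow_sub]
  · have : i = j := Fin.ext h
    simp [rootSet, this]
  · have hne : i ≠ j := fun e => by simp [e] at h
    have hij : (j.val : ℝ) < i.val := by exact_mod_cast h
    have hs : 0 < -(2 * Real.sin (Real.pi * ((j.val : ℝ) - i.val) / (n + 1))) := by
      rw [← mul_neg, ← Real.sin_neg]
      refine mul_pos two_pos (Real.sin_pos_of_pos_of_lt_pi ?_ ?_)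
      · rw [← neg_div]
        exact div_pos (by nlinarith) hN
      · rw [← neg_div, div_lt_iff₀ hN]
        nlinarith
    have hk := key (-1)
    have hno : ¬ i.val < j.val := by omega
    simp only [rootSet, Set.mem_ofPred_eq, ne_eq, hne, not_false_eq_true, true_and, h, hno,
      false_and, false_or]
    rw [neg_one_mul, ← sub_eq_add_neg] at hk
    rw [← hk, ← same_ray_iff _ _ _ hs, omega_pow_sub]
    have he : (((-(2 * Real.sin (Real.pi * ((j.val : ℝ) - i.val) / (n + 1))) : ℝ)) : ℂ) *
        Complex.exp (((Real.pi * ((i.val : ℝ) + j.val) / (n + 1) + Real.pi / 2 +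
          ((-1 : ℤ) : ℝ) * Real.pi : ℝ) : ℂ) * Complex.I) =
        ((2 * Real.sin (Real.pi * ((j.val : ℝ) - i.val) / (n + 1)) : ℝ) : ℂ) *
        Complex.exp (((Real.pi * ((i.val : ℝ) + j.val) / (n + 1) + Real.pi / 2 : ℝ) : ℂ) *
          Complex.I) := by
      have h1 : (((Real.pi * ((i.val : ℝ) + j.val) / (n + 1) + Real.pi / 2 +
          ((-1 : ℤ) : ℝ) * Real.pi : ℝ) : ℂ) * Complex.I) =
          (((Real.pi * ((i.val : ℝ) + j.val) / (n + 1) + Real.pi / 2 : ℝ) : ℂ) * Complex.I)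
            - Real.pi * Complex.I := by
        push_cast; ring
      rw [h1, Complex.exp_sub, Complex.exp_pi_mul_I, Complex.ofReal_neg]
      ring
    rw [he]

theorem rootSet_one (n : ℕ) : rootSet n 1 = rootSet n (((n + 1 : ℤ) : ℝ) / ((n : ℝ) + 1)) := by
  have : (n : ℝ) + 1 ≠ 0 := by positivity
  congr 1; push_cast; field_simp

theorem rootSet_two (n : ℕ) : rootSet n (1 + 1 / ((n : ℝ) + 1)) =
    rootSet n (((n + 2 : ℤ) : ℝ) / ((n : ℝ) + 1)) := by
  have : (n : ℝ) + 1 ≠ 0 := by positivity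
  congr 1; push_cast; field_simp; ring

theorem dvd_iff_of_lt {N X : ℤ} (h0 : 0 < X) (h1 : X < 2 * N) : N ∣ X ↔ X = N := by
  refine ⟨?_, fun h => h ▸ dvd_rfl⟩
  rintro ⟨k, rfl⟩
  have hN : 0 < N := by linarith
  have hk : 0 < k := pos_of_mul_pos_right h0 hN.le
  have hk2 : k < 2 := by nlinarith
  have : k = 1 := by omega
  rw [this, mul_one]

theorem dvd_iff_of_abs_lt {N X : ℤ} (h0 : -N < X) (h1 : X < N) : N ∣ X ↔ X = 0 := by
  refine ⟨fun h => Int.eq_zero_of_abs_lt_dvd h (abs_lt.2 ⟨h0, h1⟩), fun h => h ▸ dvd_zero N⟩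

/-- `R_1`: `i + j = (3n+1)/2` if `i < j`, and `i + j = (n-1)/2` if `i > j`, for `n` odd;
`i + j = (3n+2)/2` if `i < j`, and `i + j = n/2` if `i > j`, for `n` even. -/
theorem mem_rootSet_one (n : ℕ) (i j : Fin (n + 1)) : (i, j) ∈ rootSet n 1 ↔
    (i.val < j.val ∧ i.val + j.val + (n + 1) / 2 = 2 * n + 1) ∨
      (j.val < i.val ∧ i.val + j.val = n / 2) := by
  have hi := i.isLt
  have hj := j.isLt
  rw [rootSet_one, mem_rootSet_iff]
  refine or_congr (and_congr_right fun h => ?_) (and_congr_right fun h => ?_) <;>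
  rcases Nat.even_or_odd' n with ⟨l, hl | hl⟩
  · have : ¬ Odd n := by rw [Nat.not_odd_iff_even]; exact ⟨l, by omega⟩
    rw [if_neg this, dvd_iff_of_lt (by omega) (by omega)]; omega
  · have : Odd n := ⟨l, hl⟩
    rw [if_pos this, dvd_iff_of_lt (by omega) (by omega)]; omega
  · have : ¬ Odd n := by rw [Nat.not_odd_iff_even]; exact ⟨l, by omega⟩
    rw [if_neg this, dvd_iff_of_abs_lt (by omega) (by omega)]; omega
  · have : Odd n := ⟨l, hl⟩
    rw [if_pos this, dvd_iff_of_abs_lt (by omega) (by omega)]; omega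

/-- `R_{1 + 1/(n+1)}`: as for `R_1`, with both values of `i + j` decreased by `1`. -/
theorem mem_rootSet_two (n : ℕ) (i j : Fin (n + 1)) :
    (i, j) ∈ rootSet n (1 + 1 / ((n : ℝ) + 1)) ↔
    (i.val < j.val ∧ i.val + j.val + (n + 1) / 2 = 2 * n) ∨
      (j.val < i.val ∧ i.val + j.val + 1 = n / 2) := by
  have hi := i.isLt
  have hj := j.isLt
  rw [rootSet_two, mem_rootSet_iff]
  refine or_congr (and_congr_right fun h => ?_) (and_congr_right fun h => ?_) <;>
  rcases Nat.even_or_odd' n with ⟨l, hl | hl⟩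
  · have : ¬ Odd n := by rw [Nat.not_odd_iff_even]; exact ⟨l, by omega⟩
    rw [if_neg this, dvd_iff_of_lt (by omega) (by omega)]; omega
  · have : Odd n := ⟨l, hl⟩
    rw [if_pos this, dvd_iff_of_lt (by omega) (by omega)]; omega
  · have : ¬ Odd n := by rw [Nat.not_odd_iff_even]; exact ⟨l, by omega⟩
    rw [if_neg this, dvd_iff_of_abs_lt (by omega) (by omega)]; omega
  · have : Odd n := ⟨l, hl⟩
    rw [if_pos this, dvd_iff_of_abs_lt (by omega) (by omega)]; omega

/-- The unipotent group `∏_{α ∈ R_k} U_α`, generated by the root groups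
`U_{x_i - x_j} = exp (ℂ E_{i,j}) = {1 + c E_{i,j}}`. -/
def rootGroup (n : ℕ) (k : ℝ) : Subgroup (SLC n) :=
  Subgroup.closure {g | ∃ i j : Fin (n + 1), ∃ hij : i ≠ j, ∃ c : ℂ,
    (i, j) ∈ rootSet n k ∧ g = Matrix.SpecialLinearGroup.transvection hij c}

/-- The Steinberg cross section
`𝓜_{n+1} = (∏_{α ∈ R_1} U_α) (∏_{α ∈ R_{1 + 1/(n+1)}} U_α) Π̂` (with `Π` for `n` even). -/
def crossSection (n : ℕ) : Set (SLC n) :=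
  {A | ∃ U ∈ rootGroup n 1, ∃ V ∈ rootGroup n (1 + 1 / ((n : ℝ) + 1)),
    A = U * V * coxeter n}

/-! ### Stokes factors of a point of `𝓜_{n+1}` -/

/-- `Q` is the family of Stokes factors belonging to `A`. The matrix `Q m` is
`Q̃_k` with `k = m/(n+1)`; in particular `Q̃_1 = Q (n+1)`,
`Q̃_{1 + 1/(n+1)} = Q (n+2)` and `Q̃_{n/(n+1)} = Q n`. The conditions are
`A = Q̃_1 Q̃_{1 + 1/(n+1)} Π̂`, the shape of the two factors, and the cyclic symmetry
`Q̃_{k + 2/(n+1)} = Π̂ Q̃_k Π̂⁻¹` (with `Π` in place of `Π̂` for `n` even). -/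
def IsStokesFamily (n : ℕ) (A : SLC n) (Q : ℤ → SLC n) : Prop :=
  Q (n + 1) ∈ rootGroup n 1 ∧
  Q (n + 2) ∈ rootGroup n (1 + 1 / ((n : ℝ) + 1)) ∧
  (∀ m : ℤ, Q (m + 2) = coxeter n * Q m * (coxeter n)⁻¹) ∧
  A = Q (n + 1) * Q (n + 2) * coxeter n

/-- A matrix `1 + N` with `N` supported on the root set `R`. -/
def HasShape {n : ℕ} (R : Set (Fin (n + 1) × Fin (n + 1))) (g : SLC n) : Prop :=
  ∀ i j, (i, j) ∉ R → (g.1 - 1) i j = 0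

/-- Root sets of which no two members compose. -/
def NoComp {n : ℕ} (R R' : Set (Fin (n + 1) × Fin (n + 1))) : Prop :=
  ∀ i j k, (i, j) ∈ R → (j, k) ∉ R'

theorem HasShape.mul_eq {n : ℕ} {R R' : Set (Fin (n + 1) × Fin (n + 1))} (h : NoComp R R')
    {g g' : SLC n} (hg : HasShape R g) (hg' : HasShape R' g') :
    (g * g').1 - 1 = (g.1 - 1) + (g'.1 - 1) := by
  have h0 : (g.1 - 1) * (g'.1 - 1) = 0 := by
    ext i k
    rw [Matrix.mul_apply]
    refine Finset.sum_eq_zero fun j _ => ?_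
    by_cases hij : (i, j) ∈ R
    · rw [hg' j k (h i j k hij), mul_zero]
    · rw [hg i j hij, zero_mul]
  have h1 : (g * g').1 = g.1 * g'.1 := rfl
  rw [h1]
  have h2 : (g.1 - 1) * (g'.1 - 1) = g.1 * g'.1 - g.1 - g'.1 + 1 := by noncomm_ring
  rw [h0] at h2
  have h3 : g.1 * g'.1 = g.1 + g'.1 - 1 := by
    rw [← sub_eq_zero, h2]; abel
  rw [h3]; abel

theorem hasShape_of_mem {n : ℕ} {k : ℝ} (h : NoComp (rootSet n k) (rootSet n k)) {g : SLC n}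
    (hg : g ∈ rootGroup n k) : HasShape (rootSet n k) g := by
  induction hg using Subgroup.closure_induction with
  | mem x hx =>
    obtain ⟨i, j, hij, c, hR, rfl⟩ := hx
    intro a b hab
    have : (i, j) ≠ (a, b) := fun e => hab (e ▸ hR)
    rw [Matrix.SpecialLinearGroup.transvection_coe, add_sub_cancel_left, Matrix.single_apply,
      if_neg (fun e => this (by rw [e.1, e.2]))]
  | one => intro a b _; simp
  | mul x y _ _ hx hy =>
    intro a b hab
    rw [HasShape.mul_eq h hx hy, Matrix.add_apply, hx a b hab, hy a b hab, add_zero]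
  | inv x _ hx =>
    have h0 : (x.1 - 1) * (x.1 - 1) = 0 := by
      ext i p
      rw [Matrix.mul_apply]
      refine Finset.sum_eq_zero fun j _ => ?_
      by_cases hij : (i, j) ∈ rootSet n k
      · rw [hx j _ (h i j _ hij), mul_zero]
      · rw [hx i j hij, zero_mul]
    have h1 : x.1 * (2 - x.1) = 1 := by
      have : x.1 * (2 - x.1) = 1 - (x.1 - 1) * (x.1 - 1) := by noncomm_ring
      rw [this, h0, sub_zero]
    have h2 : (x⁻¹).1 * x.1 = 1 := congrArg Subtype.val (inv_mul_cancel x)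
    have h3 : (x⁻¹).1 = 2 - x.1 := by
      calc (x⁻¹).1 = (x⁻¹).1 * (x.1 * (2 - x.1)) := by rw [h1, mul_one]
        _ = 2 - x.1 := by rw [← mul_assoc, h2, one_mul]
    intro a b hab
    have h4 : (x⁻¹).1 - 1 = -(x.1 - 1) := by
      rw [h3, ← one_add_one_eq_two]; abel
    rw [h4, Matrix.neg_apply, hx a b hab, neg_zero]

/-- A point `A` of `𝓜_{n+1}` determines all its Stokes factors. -/
theorem existsUnique_isStokesFamily (n : ℕ) {A : SLC n} (hA : A ∈ crossSection n) :
    ∃! Q, IsStokesFamily n A Q := by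
  obtain ⟨U, hU, V, hV, hUV⟩ := hA
  refine existsUnique_of_exists_of_unique ?_ ?_
  · refine ⟨fun m => if Even (m - (n + 1)) then
      coxeter n ^ ((m - (n + 1)) / 2) * U * (coxeter n ^ ((m - (n + 1)) / 2))⁻¹ else
      coxeter n ^ ((m - (n + 2)) / 2) * V * (coxeter n ^ ((m - (n + 2)) / 2))⁻¹, ?_⟩
    have h1 : ¬ Even ((n : ℤ) + 2 - (n + 1)) := by
      rw [Int.not_even_iff_odd]; exact ⟨0, by ring⟩
    refine ⟨by simpa using hU, ?_, ?_, ?_⟩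
    · simp only [h1, if_false]; simpa using hV
    · intro m
      have e1 : (m + 2 - ((n : ℤ) + 1)) / 2 = 1 + (m - (n + 1)) / 2 := by omega
      have e2 : (m + 2 - ((n : ℤ) + 2)) / 2 = 1 + (m - (n + 2)) / 2 := by omega
      have e3 : Even (m + 2 - ((n : ℤ) + 1)) ↔ Even (m - ((n : ℤ) + 1)) := by
        rw [Int.even_iff, Int.even_iff]; omega
      simp only [e1, e2, e3]
      split_ifs <;> rw [_root_.zpow_one_add] <;> group
    · simp only [h1, if_false]; simpa using hUV
  · rintro Q Q' ⟨a1, a2, a3, a4⟩ ⟨b1, b2, b3, b4⟩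
    have n11 : NoComp (rootSet n 1) (rootSet n 1) := by
      intro i j k; rw [mem_rootSet_one, mem_rootSet_one]; omega
    have n22 : NoComp (rootSet n (1 + 1 / ((n : ℝ) + 1))) (rootSet n (1 + 1 / ((n : ℝ) + 1))) := by
      intro i j k; rw [mem_rootSet_two, mem_rootSet_two]; omega
    have n12 : NoComp (rootSet n 1) (rootSet n (1 + 1 / ((n : ℝ) + 1))) := by
      intro i j k; rw [mem_rootSet_one, mem_rootSet_two]; omega
    have disj : ∀ i j, (i, j) ∈ rootSet n 1 → (i, j) ∉ rootSet n (1 + 1 / ((n : ℝ) + 1)) := by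
      intro i j; rw [mem_rootSet_one, mem_rootSet_two]; omega
    have hprod : Q (n + 1) * Q (n + 2) = Q' (n + 1) * Q' (n + 2) :=
      mul_right_cancel (a4.symm.trans b4)
    have s1 := hasShape_of_mem n11 a1
    have s2 := hasShape_of_mem n22 a2
    have t1 := hasShape_of_mem n11 b1
    have t2 := hasShape_of_mem n22 b2
    have hsum := HasShape.mul_eq n12 s1 s2
    rw [hprod, HasShape.mul_eq n12 t1 t2] at hsum
    have hq1 : Q (n + 1) = Q' (n + 1) := by
      apply Matrix.SpecialLinearGroup.ext
      intro i j
      by_cases h : (i, j) ∈ rootSet n 1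
      · have := congrFun (congrFun hsum i) j
        rw [Matrix.add_apply, Matrix.add_apply, s2 i j (disj i j h), t2 i j (disj i j h),
          add_zero, add_zero] at this
        exact (sub_left_inj.1 this).symm
      · exact sub_left_inj.1 ((s1 i j h).trans (t1 i j h).symm)
    have hq2 : Q (n + 2) = Q' (n + 2) := by
      rw [hq1] at hprod
      exact mul_left_cancel hprod
    have step : ∀ m, Q m = Q' m ↔ Q (m + 2) = Q' (m + 2) := by
      intro m
      rw [a3, b3]
      simp
    have all : ∀ m₀ : ℤ, Q m₀ = Q' m₀ → ∀ k : ℤ, Q (m₀ + 2 * k) = Q' (m₀ + 2 * k) := by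
      intro m₀ h k
      induction k using Int.induction_on with
      | zero => simpa using h
      | succ k ih =>
        have := (step _).1 ih
        rwa [show m₀ + 2 * (k : ℤ) + 2 = m₀ + 2 * (k + 1) by ring] at this
      | pred k ih =>
        rw [step, show m₀ + 2 * (-(k : ℤ) - 1) + 2 = m₀ + 2 * -(k : ℤ) by ring]
        exact ih
    funext m
    rcases Int.even_or_odd' (m - (n + 1)) with ⟨k, hk | hk⟩
    · have := all _ hq1 k
      rwa [show (n : ℤ) + 1 + 2 * k = m by omega] at this
    · have := all _ hq2 k
      rwa [show (n : ℤ) + 2 + 2 * k = m by omega] at this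

open Classical in
/-- The Stokes factors of `A ∈ 𝓜_{n+1}`, `stokesFactor n A m = Q̃_{m/(n+1)}`: the family
`Q` with `IsStokesFamily n A Q`, which is unique (`existsUnique_isStokesFamily`).
Off `𝓜_{n+1}` the value is irrelevant. -/
noncomputable def stokesFactor (n : ℕ) (A : SLC n) : ℤ → SLC n :=
  if h : ∃ Q, IsStokesFamily n A Q then h.choose else 1

/-- The Stokes matrix `S̃_1 = Q̃_1 Q̃_{1 + 1/(n+1)} ⋯ Q̃_{1 + n/(n+1)}`. -/
noncomputable def stokesMatrix (n : ℕ) (A : SLC n) : SLC n :=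
  (List.ofFn fun i : Fin (n + 1) => stokesFactor n A ((n : ℤ) + 1 + (i : ℕ))).prod

/-! ### The maps on the universal centralizer -/

/-- `Ad_F X = F X F⁻¹`. -/
def Ad {n : ℕ} (F : GLC n) (X : SLC n) : SLC n :=
  ⟨(F : Matrix (Fin (n + 1)) (Fin (n + 1)) ℂ) * (X : Matrix (Fin (n + 1)) (Fin (n + 1)) ℂ)
      * ((F⁻¹ : GLC n) : Matrix (Fin (n + 1)) (Fin (n + 1)) ℂ), by
    have h := congrArg Matrix.det (Units.mul_inv F)
    rw [Matrix.det_mul, Matrix.det_one] at h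
    rw [Matrix.det_mul, Matrix.det_mul, X.2, mul_one, h]⟩

/-- Entrywise complex conjugation `X ↦ X̄`. -/
noncomputable def conjSL {n : ℕ} (X : SLC n) : SLC n :=
  Matrix.SpecialLinearGroup.map (starRingEnd ℂ) X

/-- `F_σ(A)`: `Π̂^{(n+1)/2}` if `n` is odd, and `(S̃_1)^T` if `n` is even. -/
noncomputable def Fsigma (n : ℕ) (A : SLC n) : GLC n :=
  if Odd n then ((coxeter n ^ ((n + 1) / 2) : SLC n) : GLC n)
  else ((stokesMatrix n A).transpose : GLC n)

/-- `F_θ(A)`: the complex conjugate of `C̃ Q̃_{n/(n+1)}` if `n` is odd, and `C` if `n` is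
even. -/
noncomputable def Ftheta (n : ℕ) (A : SLC n) : GLC n :=
  if Odd n then
    Matrix.GeneralLinearGroup.map (starRingEnd ℂ) (reflCTildeGL n * (stokesFactor n A n : GLC n))
  else reflCGL n

/-- The universal centralizer
`𝓩_{n+1} = {(B, A) | B ∈ SL_{n+1} ℂ, A ∈ 𝓜_{n+1}, B A = A B}`. -/
def univCentralizer (n : ℕ) : Set (SLC n × SLC n) :=
  {z | z.2 ∈ crossSection n ∧ z.1 * z.2 = z.2 * z.1}

/-- `σ(B, A) = (Ad_{F_σ(A)} B^{-T}, Ad_{F_σ(A)} A^{-T})`. -/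
noncomputable def sigmaMap (n : ℕ) (z : SLC n × SLC n) : SLC n × SLC n :=
  (Ad (Fsigma n z.2) (z.1⁻¹).transpose, Ad (Fsigma n z.2) (z.2⁻¹).transpose)

/-- `θ(B, A) = (Ad_{F_θ(A)} B̄, Ad_{F_θ(A)} Ā⁻¹)`. -/
noncomputable def thetaMap (n : ℕ) (z : SLC n × SLC n) : SLC n × SLC n :=
  (Ad (Ftheta n z.2) (conjSL z.1), Ad (Ftheta n z.2) (conjSL z.2)⁻¹)

end TTStarToda

namespace TTStarToda

section

variable {n : ℕ}

/-! ### Symmetries of the root sets -/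

/-! Write `P` for `coxeter n`, `φ` for `X ↦ X^{-T}` and `ψ` for `conjReflection n`. These are
commuting involutive automorphisms with `φ P = P` and `ψ P = P⁻¹`. After the constants are absorbed,
`σ` is conjugation by a twist `s(Q)` followed by `φ`, and `θ` is conjugation by `t(Q)` followed by
`ψ`, with an extra inverse in the `A` slot (`sigmaMap_eq`, `thetaMap_eq`).

The twists are chosen so that Stokes families go to Stokes families: `σ` sends `Q m` to `φ (Q (m + n
+ 1))`, and `θ` sends it to `(ψ (Q (c - m)))⁻¹`, where `c = 2n` for `n` odd and `c = 2n + 1` for `n`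
even. The reason is geometric. Transposition turns each singular direction by `π`, complex
conjugation reflects it, and conjugation by `P` rotates it by `2π/(n+1)`. Hence both images lie in
the cross section (`IsStokesFamily.sigma`, `IsStokesFamily.theta`), and by uniqueness these families
are the Stokes factors of the images, so the second application of a map can be computed.

The three identities then compare products of twists. For `θ ∘ θ` the product is `1`. For `σ ∘ σ`
and for `σ ∘ θ` against `θ ∘ σ` the discrepancy is `P^{±(n+1)}`, a scalar, when `n` is odd. When `n`
is even it is `A^{±(n+1)}`, because `2n + 2` consecutive Stokes factors multiply to `A^(n+1)`.
Either way it commutes with everything that commutes with `A`, in particular with `A` and `B`. -/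

theorem omega_pow_card (n : ℕ) : omega n ^ (n + 1) = 1 := by
  rw [omega, ← Complex.exp_nat_mul]
  refine Complex.exp_eq_one_iff.2 ⟨1, ?_⟩
  have : (n : ℂ) + 1 ≠ 0 := by exact_mod_cast Nat.succ_ne_zero n
  push_cast
  field_simp

theorem omega_pow_val_add (i j : Fin (n + 1)) :
    omega n ^ (i + j).val = omega n ^ i.val * omega n ^ j.val := by
  rw [Fin.val_add, ← pow_eq_pow_mod _ (omega_pow_card n), pow_add]

theorem omega_pow_val_add_one (i : Fin (n + 1)) :
    omega n ^ (i + 1).val = omega n ^ i.val * omega n := by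
  rw [Fin.val_add, ← pow_eq_pow_mod _ (omega_pow_card n), pow_add]
  congr 1
  -- For `n = 0` the element `1 : Fin 1` has value `0`, so the equality needs `ω = 1`.
  rcases n with _ | n
  · simp [show omega 0 = 1 by simpa using omega_pow_card 0]
  · simp

theorem norm_omega (n : ℕ) : ‖omega n‖ = 1 :=
  Complex.norm_eq_one_of_pow_eq_one (omega_pow_card n) n.succ_ne_zero

theorem omega_pow_val_neg (i : Fin (n + 1)) :
    omega n ^ (-i).val = starRingEnd ℂ (omega n ^ i.val) := by
  have h : omega n ^ (-i).val * omega n ^ i.val = 1 := by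
    rw [← omega_pow_val_add]; simp
  rw [eq_inv_of_mul_eq_one_left h, Complex.inv_eq_conj]
  rw [norm_pow, norm_omega, one_pow]

theorem exp_singularAngle_add_two_div (n : ℕ) (k : ℝ) :
    Complex.exp ((singularAngle n k : ℂ) * Complex.I) =
      Complex.exp ((singularAngle n (k + 2 / ((n : ℝ) + 1)) : ℂ) * Complex.I) * omega n := by
  rw [omega, ← Complex.exp_add]
  congr 1
  have : (n : ℂ) + 1 ≠ 0 := by exact_mod_cast Nat.succ_ne_zero n
  simp only [singularAngle]
  split_ifs <;> push_cast <;> field_simp <;> ring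

/-- Raising both indices by one multiplies `ω^j - ω^i` by `ω`, and raising `k` by `2/(n+1)` turns
the ray back by the same angle `2π/(n+1)`. -/
theorem mem_rootSet_add_one_iff (k : ℝ) (i j : Fin (n + 1)) :
    (i + 1, j + 1) ∈ rootSet n k ↔ (i, j) ∈ rootSet n (k + 2 / ((n : ℝ) + 1)) := by
  have h0 : omega n ≠ 0 := by
    rw [← norm_ne_zero_iff, norm_omega]; exact one_ne_zero
  simp only [rootSet, Set.mem_ofPred_eq, omega_pow_val_add_one, exp_singularAngle_add_two_div n k,
    ← sub_mul, ← mul_assoc, mul_left_inj' h0, ne_eq, add_left_inj]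

theorem exp_singularAngle_add_one (n : ℕ) (k : ℝ) :
    Complex.exp ((singularAngle n (k + 1) : ℂ) * Complex.I) =
      -Complex.exp ((singularAngle n k : ℂ) * Complex.I) := by
  have h : (singularAngle n (k + 1) : ℂ) * Complex.I =
      (singularAngle n k : ℂ) * Complex.I - Real.pi * Complex.I := by
    simp only [singularAngle]
    split_ifs <;> push_cast <;> ring
  rw [h, Complex.exp_sub, Complex.exp_pi_mul_I, div_neg, div_one]

/-- The swap negates `ω^j - ω^i`, and `θ_{k+1} = θ_k - π` is the opposite ray. -/
theorem mem_rootSet_swap_iff (k : ℝ) (i j : Fin (n + 1)) :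
    (j, i) ∈ rootSet n k ↔ (i, j) ∈ rootSet n (k + 1) := by
  simp only [rootSet, Set.mem_ofPred_eq, exp_singularAngle_add_one, mul_neg, ne_eq,
    eq_comm (a := j), ← neg_eq_iff_eq_neg, neg_sub]

theorem singularAngle_reflect (n : ℕ) (k : ℝ) :
    singularAngle n (2 - (if Odd n then 2 else 1) / ((n : ℝ) + 1) - k) = -singularAngle n k := by
  simp only [singularAngle]
  split_ifs <;> field_simp <;> ring

/-- Negating indices conjugates the powers of `ω`, hence reflects the ray `θ_k` to `-θ_k`. For `k =
m/(n+1)` the reflected parameter has numerator `2n - m` or `2n + 1 - m`, which is where the constant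
in `thetaFamily` comes from. -/
theorem mem_rootSet_neg_iff (k : ℝ) (i j : Fin (n + 1)) :
    (-i, -j) ∈ rootSet n k ↔
      (i, j) ∈ rootSet n (2 - (if Odd n then 2 else 1) / ((n : ℝ) + 1) - k) := by
  have h : ∀ r : ℝ, (r : ℂ) * Complex.exp (((-singularAngle n k : ℝ) : ℂ) * Complex.I) =
      starRingEnd ℂ ((r : ℂ) * Complex.exp ((singularAngle n k : ℂ) * Complex.I)) := by
    intro r
    rw [map_mul, Complex.conj_ofReal, ← Complex.exp_conj, map_mul, Complex.conj_ofReal,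
      Complex.conj_I, Complex.ofReal_neg, neg_mul, mul_neg]
  simp only [rootSet, Set.mem_ofPred_eq, singularAngle_reflect, h, omega_pow_val_neg, ne_eq,
    neg_inj, ← map_sub]
  refine and_congr_right fun _ => exists_congr fun r => and_congr_right fun _ => ?_
  rw [← (starRingEnd ℂ).injective.eq_iff, Complex.conj_conj]

/-! ### Monomial matrices with signs -/

/-- The matrix with entry `d i` at `(i, e i)`. -/
def monomial (e : Equiv.Perm (Fin (n + 1))) (d : Fin (n + 1) → ℂ) :
    Matrix (Fin (n + 1)) (Fin (n + 1)) ℂ :=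
  Matrix.of fun i j => if j = e i then d i else 0

/-- Conjugation by a signed permutation matrix relabels root subgroups. This one computation serves
both `P` and the reflection. -/
theorem monomial_mul_transvection (e : Equiv.Perm (Fin (n + 1))) {d : Fin (n + 1) → ℂ}
    (hd : ∀ i, d i * d i = 1) (i j : Fin (n + 1)) (c : ℂ) :
    monomial e d * transvection (e i) (e j) c = transvection i j (d i * c * d j) * monomial e d := by
  rw [transvection, transvection, mul_add, add_mul, mul_one, one_mul]
  congr 1
  ext a b
  simp only [monomial, Matrix.mul_apply, Matrix.of_apply, Matrix.single_apply]
  rw [Finset.sum_eq_single (e a) (fun x _ hx => by rw [if_neg hx, zero_mul]) (by simp),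
    Finset.sum_eq_single j (fun x _ hx => by rw [if_neg (fun h => hx h.2.symm), zero_mul])
      (by simp)]
  by_cases ha : i = a
  · subst ha
    simp [mul_assoc, hd, eq_comm]
  · simp [ha]

/-- The sign of the last row of `coxeter n`. -/
noncomputable def coxeterSign (n : ℕ) : ℂ := if Odd n then -1 else 1

theorem coxeterSign_mul_self (n : ℕ) : coxeterSign n * coxeterSign n = 1 := by
  unfold coxeterSign; split_ifs <;> simp

/-- The signs of the rows of `coxeter n`. -/
noncomputable def coxeterSigns (n : ℕ) (i : Fin (n + 1)) : ℂ :=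
  if i = Fin.last n then coxeterSign n else 1

theorem coxeter_val (n : ℕ) :
    (coxeter n).1 = monomial (Equiv.addRight 1) (coxeterSigns n) := by
  ext i j
  by_cases h : Odd n <;> by_cases hi : i = Fin.last n <;>
    simp [coxeter, cycHat, cyc, monomial, coxeterSigns, coxeterSign, h, hi, Matrix.diagonal_mul]

/-- The bound on `k` ensures that the walk `i, i + 1, …` wraps around at most once, so the sign of
the last row is collected at most once. -/
theorem coxeter_pow_apply (k : ℕ) (hk : k ≤ n + 1) (i j : Fin (n + 1)) :
    (coxeter n ^ k).1 i j =
      if j = i + Fin.ofNat (n + 1) k then (if n + 1 ≤ i.val + k then coxeterSign n else 1) else 0 := by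
  induction k generalizing i with
  | zero =>
    have := i.isLt
    simp [Matrix.one_apply, eq_comm, show ¬ n + 1 ≤ i.val by omega]
  | succ k ih =>
    rw [pow_succ', Matrix.SpecialLinearGroup.coe_mul, Matrix.mul_apply, coxeter_val,
      Finset.sum_eq_single (i + 1) (fun x _ hx => by simp [monomial, hx]) (by simp),
      ih (by omega), monomial, Matrix.of_apply, if_pos (by rfl), coxeterSigns]
    have hj : j = i + 1 + Fin.ofNat (n + 1) k ↔ j = i + Fin.ofNat (n + 1) (k + 1) := by
      rw [add_assoc, show 1 + Fin.ofNat (n + 1) k = Fin.ofNat (n + 1) (k + 1) by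
        ext; simp [Fin.val_add, add_comm]]
    simp only [hj]
    -- From the last row the sign is picked up now, and the remaining `k ≤ n` steps start at row `0`
    -- and cannot wrap again.
    by_cases hi : i = Fin.last n
    · subst hi
      simp [show ¬ n + 1 ≤ k by omega, show n + 1 ≤ n + (k + 1) by omega]
    · have h1 : (i + 1).val = i.val + 1 := by
        rw [Fin.val_add_one, if_neg hi]
      simp only [hi, h1, if_false, one_mul, show i.val + 1 + k = i.val + (k + 1) by omega]

theorem coxeter_pow_card (n : ℕ) :
    (coxeter n ^ (n + 1)).1 = coxeterSign n • (1 : Matrix (Fin (n + 1)) (Fin (n + 1)) ℂ) := by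
  ext i j
  rw [coxeter_pow_apply _ le_rfl]
  simp [Matrix.one_apply, eq_comm]

theorem coxeter_pow_card_of_even (h : ¬ Odd n) : coxeter n ^ (n + 1) = 1 := by
  apply Subtype.ext
  rw [coxeter_pow_card, coxeterSign, if_neg h, one_smul, Matrix.SpecialLinearGroup.coe_one]

theorem coxeter_pow_card_comm (X : SLC n) : coxeter n ^ (n + 1) * X = X * coxeter n ^ (n + 1) := by
  apply Subtype.ext
  rw [Matrix.SpecialLinearGroup.coe_mul, Matrix.SpecialLinearGroup.coe_mul, coxeter_pow_card]
  simp

theorem monomial_mul_monomial (e e' : Equiv.Perm (Fin (n + 1))) (d d' : Fin (n + 1) → ℂ) :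
    monomial e d * monomial e' d' = monomial (e.trans e') (fun i => d i * d' (e i)) := by
  ext i j
  rw [Matrix.mul_apply, Finset.sum_eq_single (e i) (fun x _ hx => by simp [monomial, hx]) (by simp)]
  simp [monomial]
  rfl

theorem monomial_eq_one {e : Equiv.Perm (Fin (n + 1))} {d : Fin (n + 1) → ℂ}
    (he : ∀ i, e i = i) (hd : ∀ i, d i = 1) : monomial e d = 1 := by
  ext i j
  simp [monomial, he, hd, Matrix.one_apply, eq_comm]

theorem transpose_monomial (e : Equiv.Perm (Fin (n + 1))) (d : Fin (n + 1) → ℂ) :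
    (monomial e d)ᵀ = monomial e.symm (fun i => d (e.symm i)) := by
  ext i j
  by_cases h : i = e j
  · subst h; simp [monomial]
  · have : j ≠ e.symm i := fun h' => h (by simp [h'])
    simp [monomial, h, this]

theorem monomial_map_conj {e : Equiv.Perm (Fin (n + 1))} {d : Fin (n + 1) → ℂ}
    (hd : ∀ i, starRingEnd ℂ (d i) = d i) : (monomial e d).map (starRingEnd ℂ) = monomial e d := by
  ext i j
  simp only [monomial, Matrix.map_apply, Matrix.of_apply, apply_ite (starRingEnd ℂ), hd, map_zero]

theorem coxeterSigns_mul_self (i : Fin (n + 1)) : coxeterSigns n i * coxeterSigns n i = 1 := by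
  unfold coxeterSigns; split_ifs <;> simp [coxeterSign_mul_self]

theorem conj_coxeterSigns (i : Fin (n + 1)) :
    starRingEnd ℂ (coxeterSigns n i) = coxeterSigns n i := by
  unfold coxeterSigns coxeterSign; split_ifs <;> simp

/-- `C̃` if `n` is odd, `C` if `n` is even. -/
def reflection (n : ℕ) : GLC n := if Odd n then reflCTildeGL n else reflCGL n

/-- The signs of the rows of `reflection n`. -/
noncomputable def reflectionSigns (n : ℕ) (i : Fin (n + 1)) : ℂ :=
  if Odd n ∧ i ≠ 0 then -1 else 1

theorem reflectionSigns_mul_self (i : Fin (n + 1)) :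
    reflectionSigns n i * reflectionSigns n i = 1 := by
  unfold reflectionSigns; split_ifs <;> simp

theorem conj_reflectionSigns (i : Fin (n + 1)) :
    starRingEnd ℂ (reflectionSigns n i) = reflectionSigns n i := by
  unfold reflectionSigns; split_ifs <;> simp

theorem reflection_val (n : ℕ) :
    (reflection n).1 = monomial (Equiv.neg _) (reflectionSigns n) := by
  ext i j
  by_cases h : Odd n <;> by_cases hi : i = 0 <;>
    simp [reflection, reflCTildeGL, reflCGL, reflCTilde, reflC, monomial, reflectionSigns, h, hi,
      Matrix.diagonal_mul]

theorem reflection_inv (n : ℕ) : (reflection n)⁻¹ = reflection n := by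
  unfold reflection; split_ifs <;> rfl

theorem reflection_val_mul_self (n : ℕ) : (reflection n).1 * (reflection n).1 = 1 := by
  have h := Units.mul_inv (reflection n)
  rwa [reflection_inv] at h

theorem reflection_val_map_conj (n : ℕ) :
    (reflection n).1.map (starRingEnd ℂ) = (reflection n).1 := by
  rw [reflection_val, monomial_map_conj conj_reflectionSigns]

theorem reflection_val_transpose (n : ℕ) : (reflection n).1ᵀ = (reflection n).1 := by
  rw [reflection_val, transpose_monomial]
  congr 1
  funext i
  simp [reflectionSigns]

/-- These are the signs in the square of `reflection n` times `coxeter n`. For `n` odd, the first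
and last factors multiply to `-1` for every `i`, since exactly one of them is `-1`; the two middle
factors do likewise. -/
theorem reflectionSigns_mul_coxeterSigns (i : Fin (n + 1)) :
    reflectionSigns n i * coxeterSigns n (-i) *
      (reflectionSigns n (-i + 1) * coxeterSigns n (-(-i + 1))) = 1 := by
  have hl : Fin.last n = -1 := by
    rw [eq_neg_iff_add_eq_zero]; simp
  have h1 : -i = -1 ↔ i = 1 := neg_inj
  have h2 : -(-i + 1) = -1 ↔ i = 0 := by rw [neg_inj]; simp
  have h3 : -i + 1 = 0 ↔ i = 1 := by rw [neg_add_eq_zero]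
  by_cases h : Odd n
  · have h01 : (1 : Fin (n + 1)) ≠ 0 := by
      obtain ⟨l, rfl⟩ := h
      exact Fin.zero_ne_one.symm
    simp only [reflectionSigns, coxeterSigns, coxeterSign, hl, h1, h2, ne_eq, h3, h, true_and,
      if_true]
    by_cases a : i = 0
    · subst a; simp [h01.symm]
    · by_cases b : i = 1 <;> simp [a, b, h01]
  · simp [reflectionSigns, coxeterSigns, coxeterSign, h]

/-! ### The homomorphisms `X ↦ X^{-T}` and `X ↦ Ad_C X̄` -/

theorem coe_transpose (X : SLC n) : X.transpose.1 = X.1ᵀ := rfl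

/-- `X ↦ X^{-T}`. -/
def invTranspose (n : ℕ) : SLC n →* SLC n where
  toFun X := X⁻¹.transpose
  map_one' := by apply Subtype.ext; simp
  map_mul' X Y := by
    apply Subtype.ext
    rw [_root_.mul_inv_rev, coe_transpose, Matrix.SpecialLinearGroup.coe_mul,
      Matrix.SpecialLinearGroup.coe_mul, Matrix.transpose_mul, coe_transpose, coe_transpose]

theorem invTranspose_apply (X : SLC n) : invTranspose n X = X⁻¹.transpose := rfl

theorem invTranspose_eq_of_mul {X Y : SLC n} (h : X.1 * Y.1ᵀ = 1) : invTranspose n X = Y := by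
  have h1 : X * Y.transpose = 1 := Subtype.ext h
  rw [invTranspose_apply, inv_eq_of_mul_eq_one_right h1]
  rfl

theorem invTranspose_invTranspose (X : SLC n) : invTranspose n (invTranspose n X) = X := by
  refine invTranspose_eq_of_mul ?_
  rw [invTranspose_apply, coe_transpose, ← Matrix.transpose_mul, ← Matrix.SpecialLinearGroup.coe_mul,
    mul_inv_cancel, Matrix.SpecialLinearGroup.coe_one, Matrix.transpose_one]

theorem invTranspose_coxeter (n : ℕ) : invTranspose n (coxeter n) = coxeter n := by
  refine invTranspose_eq_of_mul ?_
  rw [coxeter_val, transpose_monomial, monomial_mul_monomial]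
  exact monomial_eq_one (by simp) (by simp [coxeterSigns_mul_self])

theorem invTranspose_transvection {i j : Fin (n + 1)} (hij : i ≠ j) (c : ℂ) :
    invTranspose n (Matrix.SpecialLinearGroup.transvection hij c) =
      Matrix.SpecialLinearGroup.transvection hij.symm (-c) := by
  refine invTranspose_eq_of_mul ?_
  have h : (transvection j i (-c))ᵀ = transvection i j (-c) := by
    simp [transvection]
  change transvection i j c * (transvection j i (-c))ᵀ = 1
  rw [h, transvection_mul_transvection_same _ _ hij, add_neg_cancel, transvection_zero]

/-- `Ad_F` as a homomorphism. -/
def adHom (F : GLC n) : SLC n →* SLC n where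
  toFun := Ad F
  map_one' := by apply Subtype.ext; simp [Ad]
  map_mul' X Y := by
    apply Subtype.ext
    change F.1 * (X.1 * Y.1) * F⁻¹.1 = F.1 * X.1 * F⁻¹.1 * (F.1 * Y.1 * F⁻¹.1)
    simp only [Matrix.mul_assoc]
    rw [← Matrix.mul_assoc F⁻¹.1 F.1, Units.inv_mul, Matrix.one_mul]

theorem adHom_apply (F : GLC n) (X : SLC n) : adHom F X = Ad F X := rfl

theorem Ad_mul (F G : GLC n) (X : SLC n) : Ad (F * G) X = Ad F (Ad G X) := by
  apply Subtype.ext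
  simp only [Ad, _root_.mul_inv_rev, Units.val_mul, Matrix.mul_assoc]

theorem Ad_coe (F X : SLC n) : Ad (F : GLC n) X = F * X * F⁻¹ := by
  apply Subtype.ext
  have h : ((F : GLC n)⁻¹) = ((F⁻¹ : SLC n) : GLC n) :=
    (map_inv (Matrix.SpecialLinearGroup.toGL) F).symm
  simp only [Ad, h]
  rfl

/-- `X ↦ Ad_{C̃} X̄`, with `C` in place of `C̃` for `n` even. -/
noncomputable def conjReflection (n : ℕ) : SLC n →* SLC n :=
  (adHom (reflection n)).comp (Matrix.SpecialLinearGroup.map (starRingEnd ℂ))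

theorem conjReflection_val (X : SLC n) : (conjReflection n X).1 =
    (reflection n).1 * X.1.map (starRingEnd ℂ) * (reflection n).1 := by
  have h : (conjReflection n X).1 =
    (reflection n).1 * X.1.map (starRingEnd ℂ) * (reflection n)⁻¹.1 := rfl
  rw [h, reflection_inv]

theorem conjReflection_conjReflection (X : SLC n) :
    conjReflection n (conjReflection n X) = X := by
  apply Subtype.ext
  have hX : (X.1.map (starRingEnd ℂ)).map (starRingEnd ℂ) = X.1 := by ext; simp
  rw [conjReflection_val, conjReflection_val, Matrix.map_mul, Matrix.map_mul, hX,
    reflection_val_map_conj, ← Matrix.mul_assoc, ← Matrix.mul_assoc, reflection_val_mul_self,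
    Matrix.one_mul, Matrix.mul_assoc, reflection_val_mul_self, Matrix.mul_one]

theorem invTranspose_conjReflection (X : SLC n) :
    invTranspose n (conjReflection n X) = conjReflection n (invTranspose n X) := by
  rw [invTranspose_apply, ← map_inv, invTranspose_apply]
  apply Subtype.ext
  rw [coe_transpose, conjReflection_val, conjReflection_val, coe_transpose, Matrix.transpose_mul,
    Matrix.transpose_mul, reflection_val_transpose, Matrix.transpose_map, Matrix.mul_assoc]

/-- A reflection inverts a rotation; the signs in `C̃` are what makes this exact for `n` odd. -/
theorem conjReflection_coxeter (n : ℕ) : conjReflection n (coxeter n) = (coxeter n)⁻¹ := by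
  rw [eq_inv_iff_mul_eq_one]
  apply Subtype.ext
  rw [Matrix.SpecialLinearGroup.coe_mul, conjReflection_val, coxeter_val,
    monomial_map_conj conj_coxeterSigns, Matrix.mul_assoc, reflection_val, monomial_mul_monomial,
    monomial_mul_monomial]
  refine monomial_eq_one (fun i => ?_) (fun i => ?_)
  · simp
  · simpa using reflectionSigns_mul_coxeterSigns i

theorem conjReflection_transvection {i j : Fin (n + 1)} (hij : i ≠ j) (c : ℂ) :
    conjReflection n (Matrix.SpecialLinearGroup.transvection hij c) =
      Matrix.SpecialLinearGroup.transvection (neg_injective.ne hij)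
        (reflectionSigns n (-i) * starRingEnd ℂ c * reflectionSigns n (-j)) := by
  apply Subtype.ext
  have h1 : (transvection i j c).map (starRingEnd ℂ) = transvection i j (starRingEnd ℂ c) := by
    ext a b
    simp [transvection, Matrix.one_apply, Matrix.single_apply, apply_ite (starRingEnd ℂ)]
  have h2 := monomial_mul_transvection (Equiv.neg (Fin (n + 1)))
    (reflectionSigns_mul_self (n := n)) (-i) (-j) (starRingEnd ℂ c)
  simp only [Equiv.neg_apply, neg_neg] at h2
  rw [conjReflection_val]
  change (reflection n).1 * (transvection i j c).map (starRingEnd ℂ) * (reflection n).1 =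
    transvection _ _ _
  rw [h1, reflection_val, h2, Matrix.mul_assoc, ← reflection_val, reflection_val_mul_self,
    Matrix.mul_one]

theorem coxeter_mul_transvection {i j : Fin (n + 1)} (hij : i ≠ j) (c : ℂ) :
    coxeter n * Matrix.SpecialLinearGroup.transvection ((add_left_injective 1).ne hij) c =
      Matrix.SpecialLinearGroup.transvection hij (coxeterSigns n i * c * coxeterSigns n j) *
        coxeter n := by
  apply Subtype.ext
  rw [Matrix.SpecialLinearGroup.coe_mul, Matrix.SpecialLinearGroup.coe_mul, coxeter_val]
  exact monomial_mul_transvection (Equiv.addRight 1) coxeterSigns_mul_self i j c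

/-! ### Symmetries of the root groups -/

theorem transvection_mem_rootGroup {k : ℝ} {i j : Fin (n + 1)} (hij : i ≠ j) (c : ℂ)
    (h : (i, j) ∈ rootSet n k) :
    Matrix.SpecialLinearGroup.transvection hij c ∈ rootGroup n k :=
  Subgroup.subset_closure ⟨i, j, hij, c, h, rfl⟩

theorem map_mem_rootGroup (φ : SLC n →* SLC n) {k k' : ℝ}
    (h : ∀ (i j : Fin (n + 1)) (hij : i ≠ j) (c : ℂ), (i, j) ∈ rootSet n k →
      φ (Matrix.SpecialLinearGroup.transvection hij c) ∈ rootGroup n k')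
    {X : SLC n} (hX : X ∈ rootGroup n k) : φ X ∈ rootGroup n k' := by
  have : rootGroup n k ≤ (rootGroup n k').comap φ := by
    refine (Subgroup.closure_le _).2 ?_
    rintro _ ⟨i, j, hij, c, hR, rfl⟩
    exact h i j hij c hR
  exact this hX

theorem rootGroup_add_two (n : ℕ) (k : ℝ) : rootGroup n (k + 2) = rootGroup n k := by
  have h : rootSet n (k + 2) = rootSet n k := by
    ext ⟨i, j⟩
    rw [← one_add_one_eq_two, ← add_assoc, ← mem_rootSet_swap_iff, ← mem_rootSet_swap_iff]
  rw [rootGroup, rootGroup, h]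

/-- Each root is sent to its negative, which belongs to the opposite singular direction. -/
theorem invTranspose_mem_rootGroup {k : ℝ} {X : SLC n} (hX : X ∈ rootGroup n k) :
    invTranspose n X ∈ rootGroup n (k + 1) :=
  map_mem_rootGroup _ (fun i j hij c h => by
    rw [invTranspose_transvection]
    exact transvection_mem_rootGroup _ _ ((mem_rootSet_swap_iff k j i).1 h)) hX

theorem conjReflection_mem_rootGroup {k : ℝ} {X : SLC n} (hX : X ∈ rootGroup n k) :
    conjReflection n X ∈
      rootGroup n (2 - (if Odd n then 2 else 1) / ((n : ℝ) + 1) - k) :=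
  map_mem_rootGroup _ (fun i j hij c h => by
    rw [conjReflection_transvection]
    refine transvection_mem_rootGroup _ _ ((mem_rootSet_neg_iff k _ _).1 ?_)
    rwa [neg_neg, neg_neg]) hX

theorem coxeter_conj_mem_rootGroup {k : ℝ} {X : SLC n} (hX : X ∈ rootGroup n k) :
    coxeter n * X * (coxeter n)⁻¹ ∈ rootGroup n (k + 2 / ((n : ℝ) + 1)) :=
  map_mem_rootGroup (MulAut.conj (coxeter n)).toMonoidHom (fun i j hij c h => by
    obtain ⟨i, rfl⟩ := add_right_surjective (1 : Fin (n + 1)) i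
    obtain ⟨j, rfl⟩ := add_right_surjective (1 : Fin (n + 1)) j
    have hij' : i ≠ j := fun e => hij (by rw [e])
    have e := mul_inv_eq_iff_eq_mul.2 (coxeter_mul_transvection hij' c)
    exact (congrArg (· ∈ rootGroup n _) e).mpr
      (transvection_mem_rootGroup _ _ ((mem_rootSet_add_one_iff k i j).1 h))) hX

theorem coxeter_inv_conj_mem_rootGroup {k : ℝ} {X : SLC n}
    (hX : X ∈ rootGroup n (k + 2 / ((n : ℝ) + 1))) :
    (coxeter n)⁻¹ * X * coxeter n ∈ rootGroup n k := by
  have h := map_mem_rootGroup (k' := k) (MulAut.conj (coxeter n)⁻¹).toMonoidHom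
    (fun i j hij c h => by
      -- The coefficient is pre-multiplied by the signs, which square to one, so that conjugation by
      -- `P` produces exactly `c`.
      have hd : coxeterSigns n i * (coxeterSigns n i * c * coxeterSigns n j) * coxeterSigns n j
          = c := by
        linear_combination (c * coxeterSigns n j * coxeterSigns n j) * coxeterSigns_mul_self i
          + c * coxeterSigns_mul_self j
      have e := coxeter_mul_transvection hij (coxeterSigns n i * c * coxeterSigns n j)
      rw [hd, ← eq_inv_mul_iff_mul_eq, ← mul_assoc] at e
      simp only [MulEquiv.toMonoidHom_eq_coe, MonoidHom.coe_coe, MulAut.conj_apply, inv_inv]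
      rw [← e]
      exact transvection_mem_rootGroup _ _ ((mem_rootSet_add_one_iff k i j).2 h)) hX
  simpa using h

/-! ### Families of Stokes factors -/

theorem isStokesFamily_stokesFactor {A : SLC n} (hA : A ∈ crossSection n) :
    IsStokesFamily n A (stokesFactor n A) := by
  have h := (existsUnique_isStokesFamily n hA).exists
  rw [stokesFactor, dif_pos h]
  exact h.choose_spec

theorem IsStokesFamily.mem_crossSection {A : SLC n} {Q : ℤ → SLC n} (hQ : IsStokesFamily n A Q) :
    A ∈ crossSection n :=
  ⟨_, hQ.1, _, hQ.2.1, hQ.2.2.2⟩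

/-- Any family with the defining properties is the family of Stokes factors. This identifies the
factors of `σ(B, A)` and `θ(B, A)` once candidates are exhibited. -/
theorem IsStokesFamily.stokesFactor_eq {A : SLC n} {Q : ℤ → SLC n} (hQ : IsStokesFamily n A Q) :
    stokesFactor n A = Q :=
  (existsUnique_isStokesFamily n hQ.mem_crossSection).unique
    (isStokesFamily_stokesFactor hQ.mem_crossSection) hQ

theorem IsStokesFamily.add_two {A : SLC n} {Q : ℤ → SLC n} (hQ : IsStokesFamily n A Q) (m : ℤ) :
    Q (m + 2) = coxeter n * Q m * (coxeter n)⁻¹ := hQ.2.2.1 m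

theorem IsStokesFamily.add_two_mul {A : SLC n} {Q : ℤ → SLC n} (hQ : IsStokesFamily n A Q)
    (m : ℤ) (k : ℕ) : Q (m + 2 * k) = coxeter n ^ k * Q m * (coxeter n ^ k)⁻¹ := by
  induction k with
  | zero => simp
  | succ k ih =>
    rw [Nat.cast_succ, mul_add, mul_one, ← add_assoc, hQ.add_two, ih, pow_succ']
    group

theorem IsStokesFamily.add_two_mul_card {A : SLC n} {Q : ℤ → SLC n} (hQ : IsStokesFamily n A Q)
    (m : ℤ) : Q (m + 2 * (n + 1)) = Q m := by
  have h := hQ.add_two_mul m (n + 1)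
  rw [coxeter_pow_card_comm, mul_inv_cancel_right] at h
  exact_mod_cast h

/-- The definition fixes the shape of two adjacent factors only; conjugation by powers of `P`
carries it to each parity class of indices. -/
theorem IsStokesFamily.mem_rootGroup {A : SLC n} {Q : ℤ → SLC n} (hQ : IsStokesFamily n A Q)
    (m : ℤ) : Q m ∈ rootGroup n ((m : ℝ) / ((n : ℝ) + 1)) := by
  have hn : (n : ℝ) + 1 ≠ 0 := by positivity
  have step (m : ℤ) : Q m ∈ rootGroup n ((m : ℝ) / ((n : ℝ) + 1)) ↔
      Q (m + 2) ∈ rootGroup n (((m + 2 : ℤ) : ℝ) / ((n : ℝ) + 1)) := by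
    have e : ((m + 2 : ℤ) : ℝ) / ((n : ℝ) + 1) = (m : ℝ) / ((n : ℝ) + 1) + 2 / ((n : ℝ) + 1) := by
      push_cast; ring
    rw [e, hQ.add_two]
    refine ⟨coxeter_conj_mem_rootGroup, fun h => ?_⟩
    have := coxeter_inv_conj_mem_rootGroup h
    simpa [mul_assoc] using this
  have all (a : ℤ) (ha : Q a ∈ rootGroup n ((a : ℝ) / ((n : ℝ) + 1))) (k : ℤ) :
      Q (a + 2 * k) ∈ rootGroup n (((a + 2 * k : ℤ) : ℝ) / ((n : ℝ) + 1)) := by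
    induction k using Int.induction_on with
    | zero => simpa using ha
    | succ k ih =>
      rw [mul_add, mul_one, ← add_assoc]
      exact (step _).1 ih
    | pred k ih =>
      rw [step, show a + 2 * (-(k : ℤ) - 1) + 2 = a + 2 * -(k : ℤ) by ring]
      exact ih
  rcases Int.even_or_odd' (m - (n + 1)) with ⟨k, hk | hk⟩
  · have h : Q (n + 1) ∈ rootGroup n (((n + 1 : ℤ) : ℝ) / ((n : ℝ) + 1)) := by
      rw [show ((n + 1 : ℤ) : ℝ) / ((n : ℝ) + 1) = 1 by push_cast; field_simp]
      exact hQ.1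
    have := all _ h k
    rwa [show (n : ℤ) + 1 + 2 * k = m by omega] at this
  · have h : Q (n + 2) ∈ rootGroup n (((n + 2 : ℤ) : ℝ) / ((n : ℝ) + 1)) := by
      rw [show ((n + 2 : ℤ) : ℝ) / ((n : ℝ) + 1) = 1 + 1 / ((n : ℝ) + 1) by
        push_cast; field_simp; ring]
      exact hQ.2.1
    have := all _ h k
    rwa [show (n : ℤ) + 2 + 2 * k = m by omega] at this

theorem isStokesFamily_of_mem {A : SLC n} {Q : ℤ → SLC n}
    (hmem : ∀ m : ℤ, Q m ∈ rootGroup n ((m : ℝ) / ((n : ℝ) + 1)))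
    (hadd : ∀ m : ℤ, Q (m + 2) = coxeter n * Q m * (coxeter n)⁻¹)
    (hA : A = Q (n + 1) * Q (n + 2) * coxeter n) : IsStokesFamily n A Q := by
  have hn : (n : ℝ) + 1 ≠ 0 := by positivity
  refine ⟨?_, ?_, hadd, hA⟩
  · have h := hmem (n + 1)
    rwa [show ((n + 1 : ℤ) : ℝ) / ((n : ℝ) + 1) = 1 by push_cast; field_simp] at h
  · have h := hmem (n + 2)
    rwa [show ((n + 2 : ℤ) : ℝ) / ((n : ℝ) + 1) = 1 + 1 / ((n : ℝ) + 1) by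
        push_cast; field_simp; ring] at h

/-! ### Products of consecutive Stokes factors -/

/-- `Q a * Q (a + 1) * ⋯ * Q (a + l - 1)`. -/
def consecutiveProd (Q : ℤ → SLC n) : ℤ → ℕ → SLC n
  | _, 0 => 1
  | a, l + 1 => Q a * consecutiveProd Q (a + 1) l

theorem prod_ofFn_eq_consecutiveProd (Q : ℤ → SLC n) (a : ℤ) (l : ℕ) :
    (List.ofFn fun i : Fin l => Q (a + (i : ℕ))).prod = consecutiveProd Q a l := by
  induction l generalizing a with
  | zero => simp [consecutiveProd]
  | succ l ih =>
    rw [List.ofFn_succ, List.prod_cons, consecutiveProd, ← ih (a + 1)]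
    simp [add_assoc, add_comm (1 : ℤ)]

theorem consecutiveProd_add (Q : ℤ → SLC n) (a : ℤ) (l l' : ℕ) :
    consecutiveProd Q a (l + l') = consecutiveProd Q a l * consecutiveProd Q (a + l) l' := by
  induction l generalizing a with
  | zero => simp [consecutiveProd]
  | succ l ih =>
    rw [Nat.succ_add, consecutiveProd, consecutiveProd, ih, mul_assoc, Nat.cast_succ,
      add_assoc a, add_comm (1 : ℤ)]

theorem consecutiveProd_two (Q : ℤ → SLC n) (a : ℤ) :
    consecutiveProd Q a 2 = Q a * Q (a + 1) := by
  simp [consecutiveProd]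

theorem consecutiveProd_comp_add (Q : ℤ → SLC n) (c a : ℤ) (l : ℕ) :
    consecutiveProd (fun m => Q (m + c)) a l = consecutiveProd Q (a + c) l := by
  induction l generalizing a with
  | zero => rfl
  | succ l ih => rw [consecutiveProd, consecutiveProd, ih, add_right_comm]

theorem map_consecutiveProd (φ : SLC n →* SLC n) (Q : ℤ → SLC n) (a : ℤ) (l : ℕ) :
    consecutiveProd (fun m => φ (Q m)) a l = φ (consecutiveProd Q a l) := by
  induction l generalizing a with
  | zero => simp [consecutiveProd]
  | succ l ih => rw [consecutiveProd, consecutiveProd, ih, map_mul]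

/-- Both `m ↦ c - m` and inversion reverse the order of the factors, so together they preserve it.
-/
theorem consecutiveProd_inv_reflect (Q : ℤ → SLC n) (c a : ℤ) (l : ℕ) :
    consecutiveProd (fun m => (Q (c - m))⁻¹) a l = (consecutiveProd Q (c - a - l + 1) l)⁻¹ := by
  induction l generalizing a with
  | zero => simp [consecutiveProd]
  | succ l ih =>
    rw [consecutiveProd, consecutiveProd_add, ih, _root_.mul_inv_rev]
    simp only [consecutiveProd, mul_one, Nat.cast_succ]
    congr 3
    · ring
    · congr 1; ring

theorem IsStokesFamily.consecutiveProd_add_two {A : SLC n} {Q : ℤ → SLC n}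
    (hQ : IsStokesFamily n A Q) (a : ℤ) (l : ℕ) :
    consecutiveProd Q (a + 2) l = coxeter n * consecutiveProd Q a l * (coxeter n)⁻¹ := by
  have h := map_consecutiveProd (MulAut.conj (coxeter n)).toMonoidHom Q a l
  rw [← consecutiveProd_comp_add Q 2 a l]
  simpa [hQ.add_two] using h

/-- Moving every `P` in the power to the right shifts each successive pair of factors by two, so the
pairs line up consecutively. -/
theorem IsStokesFamily.consecutiveProd_two_mul {A : SLC n} {Q : ℤ → SLC n}
    (hQ : IsStokesFamily n A Q) (a : ℤ) (k : ℕ) :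
    consecutiveProd Q a (2 * k) * coxeter n ^ k = (Q a * Q (a + 1) * coxeter n) ^ k := by
  induction k with
  | zero => simp [consecutiveProd]
  | succ k ih =>
    rw [show 2 * (k + 1) = 2 + 2 * k by ring, consecutiveProd_add, consecutiveProd_two, Nat.cast_ofNat,
      hQ.consecutiveProd_add_two, pow_succ', pow_succ' (Q a * Q (a + 1) * coxeter n), ← ih]
    group

/-- Both sides are the product of `l + 2` consecutive factors times `P`, split at opposite ends.
Conjugation by the product of `l` factors thus shifts `Q a * Q (a + 1) * P` by `l`, even for odd
`l`, where no power of `P` can do it. -/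
theorem IsStokesFamily.mul_consecutiveProd {A : SLC n} {Q : ℤ → SLC n}
    (hQ : IsStokesFamily n A Q) (a : ℤ) (l : ℕ) :
    Q a * Q (a + 1) * coxeter n * consecutiveProd Q a l =
      consecutiveProd Q a l * (Q (a + l) * Q (a + l + 1) * coxeter n) := by
  have h1 := consecutiveProd_add Q a 2 l
  have h2 := consecutiveProd_add Q a l 2
  rw [add_comm, h2, consecutiveProd_two, consecutiveProd_two, Nat.cast_ofNat,
    hQ.consecutiveProd_add_two] at h1
  rw [← mul_assoc, h1]
  group

/-! ### The two involutions on Stokes families -/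

/-- The element `G` with `σ(B, A) = ((G B G⁻¹)^{-T}, (G A G⁻¹)^{-T})`. -/
def sigmaTwist (n : ℕ) (Q : ℤ → SLC n) : SLC n :=
  if Odd n then coxeter n ^ ((n + 1) / 2) else (consecutiveProd Q (n + 1) (n + 1))⁻¹

/-- The element `H` for which `θ(B, A)` is `(H B H⁻¹, H A⁻¹ H⁻¹)` up to `conjReflection n`. -/
def thetaTwist (n : ℕ) (Q : ℤ → SLC n) : SLC n :=
  if Odd n then Q n else 1

/-- The effect of `σ` on Stokes factors. -/
def sigmaFamily (Q : ℤ → SLC n) (m : ℤ) : SLC n :=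
  invTranspose n (Q (m + (n + 1)))

/-- The effect of `θ` on Stokes factors. -/
noncomputable def thetaFamily (Q : ℤ → SLC n) (m : ℤ) : SLC n :=
  (conjReflection n (Q (2 * n + (if Odd n then 0 else 1) - m)))⁻¹

/-- `Ad_F X^{-T}` equals `φ` of the conjugate of `X` by `F^{-T}`. That twist is `P^{(n+1)/2}` itself
for `n` odd, since `P` is orthogonal, and `S̃_1⁻¹` for `n` even. -/
theorem sigmaMap_eq (z : SLC n × SLC n) : sigmaMap n z =
    (invTranspose n (MulAut.conj (sigmaTwist n (stokesFactor n z.2)) z.1),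
      invTranspose n (MulAut.conj (sigmaTwist n (stokesFactor n z.2)) z.2)) := by
  have h (X : SLC n) : Ad (Fsigma n z.2) X⁻¹.transpose =
      invTranspose n (MulAut.conj (sigmaTwist n (stokesFactor n z.2)) X) := by
    rw [Fsigma, sigmaTwist, MulAut.conj_apply, map_mul, map_mul, map_inv, ← invTranspose_apply]
    split_ifs with hn
    · rw [Ad_coe, map_pow, invTranspose_coxeter]
    · rw [Ad_coe, invTranspose_apply (_⁻¹), inv_inv, stokesMatrix]
      have e := prod_ofFn_eq_consecutiveProd (stokesFactor n z.2) (n + 1) (n + 1)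
      rw [e]
  exact Prod.ext (h z.1) (h z.2)

theorem thetaMap_eq (z : SLC n × SLC n) : thetaMap n z =
    (conjReflection n (MulAut.conj (thetaTwist n (stokesFactor n z.2)) z.1),
      (conjReflection n (MulAut.conj (thetaTwist n (stokesFactor n z.2)) z.2))⁻¹) := by
  have h (X : SLC n) : Ad (Ftheta n z.2) (conjSL X) =
      conjReflection n (MulAut.conj (thetaTwist n (stokesFactor n z.2)) X) := by
    have hr := reflection_val_map_conj n
    simp only [Ftheta, thetaTwist, conjReflection, MonoidHom.comp_apply, adHom_apply]
    unfold reflection at hr ⊢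
    split_ifs with hn
    · rw [if_pos hn] at hr
      have h1 : Matrix.GeneralLinearGroup.map (starRingEnd ℂ) (reflCTildeGL n) = reflCTildeGL n :=
        Units.ext hr
      have h2 : Matrix.GeneralLinearGroup.map (starRingEnd ℂ) (stokesFactor n z.2 n : GLC n) =
          (conjSL (stokesFactor n z.2 n) : GLC n) := Units.ext rfl
      rw [map_mul, h1, h2, Ad_mul, Ad_coe, MulAut.conj_apply, map_mul, map_mul, map_inv]
      rfl
    · rw [map_one, MulAut.one_apply]
      rfl
  refine Prod.ext (h z.1) ?_
  change Ad (Ftheta n z.2) (conjSL z.2)⁻¹ = _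
  rw [← adHom_apply, map_inv, adHom_apply, h]

/-- The twist shifts the factorization of `A` by `n + 1` indices: an even shift is given by a power
of `P`, an odd one by sliding `A` through `S̃_1`. -/
theorem IsStokesFamily.conj_sigmaTwist {A : SLC n} {Q : ℤ → SLC n} (hQ : IsStokesFamily n A Q) :
    MulAut.conj (sigmaTwist n Q) A =
      Q (n + 1 + (n + 1)) * Q (n + 2 + (n + 1)) * coxeter n := by
  rw [MulAut.conj_apply, sigmaTwist, hQ.2.2.2]
  split_ifs with hn
  · have h2 : (n : ℤ) + 1 = 2 * ((n + 1) / 2 : ℕ) := by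
      obtain ⟨l, rfl⟩ := hn; omega
    have e (m : ℤ) : Q (m + (n + 1)) =
        coxeter n ^ ((n + 1) / 2) * Q m * (coxeter n ^ ((n + 1) / 2))⁻¹ := by
      rw [← hQ.add_two_mul, ← h2]
    rw [e, e]
    group
  · have h := hQ.mul_consecutiveProd (n + 1) (n + 1)
    rw [inv_inv, mul_assoc, inv_mul_eq_iff_eq_mul]
    push_cast at h
    rwa [show (n : ℤ) + 1 + 1 = n + 2 by ring,
      show (n : ℤ) + 1 + (n + 1) + 1 = n + 2 + (n + 1) by ring] at h

theorem IsStokesFamily.sigma {A : SLC n} {Q : ℤ → SLC n} (hQ : IsStokesFamily n A Q) :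
    IsStokesFamily n (invTranspose n (MulAut.conj (sigmaTwist n Q) A)) (sigmaFamily Q) := by
  have hn : (n : ℝ) + 1 ≠ 0 := by positivity
  refine isStokesFamily_of_mem (fun m => ?_) (fun m => ?_) ?_
  · rw [← rootGroup_add_two]
    have h := invTranspose_mem_rootGroup (hQ.mem_rootGroup (m + (n + 1)))
    rwa [show ((m + (n + 1) : ℤ) : ℝ) / ((n : ℝ) + 1) + 1 = (m : ℝ) / ((n : ℝ) + 1) + 2 by
      push_cast; field_simp; ring] at h
  · rw [sigmaFamily, sigmaFamily, add_right_comm, hQ.add_two, map_mul, map_mul, map_inv,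
      invTranspose_coxeter]
  · rw [hQ.conj_sigmaTwist, map_mul, map_mul, invTranspose_coxeter]
    rfl

/-- Moving `P⁻¹` to the right gives `A⁻¹ = (Q n)⁻¹ (Q (n-1))⁻¹ P⁻¹`, already the required form for
`n` even. For `n` odd the reflection needs indices one lower, and conjugation by `Q n` moves its
inverse to the other end. -/
theorem IsStokesFamily.conj_thetaTwist_inv {A : SLC n} {Q : ℤ → SLC n}
    (hQ : IsStokesFamily n A Q) : (MulAut.conj (thetaTwist n Q) A)⁻¹ =
      (Q (2 * n + (if Odd n then 0 else 1) - (n + 1)))⁻¹ *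
        (Q (2 * n + (if Odd n then 0 else 1) - (n + 2)))⁻¹ * (coxeter n)⁻¹ := by
  rw [MulAut.conj_apply, thetaTwist, hQ.2.2.2]
  have h1 := hQ.add_two (n - 1)
  have h2 := hQ.add_two n
  have h3 := hQ.add_two (n - 2)
  rw [show (n : ℤ) - 1 + 2 = n + 1 by ring] at h1
  rw [show (n : ℤ) - 2 + 2 = n by ring] at h3
  split_ifs with hn
  · rw [show 2 * (n : ℤ) + 0 - (n + 1) = n - 1 by ring,
      show 2 * (n : ℤ) + 0 - (n + 2) = n - 2 by ring, h1, h2, h3]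
    group
  · rw [show 2 * (n : ℤ) + 1 - (n + 1) = n by ring,
      show 2 * (n : ℤ) + 1 - (n + 2) = n - 1 by ring, h1, h2]
    group

theorem IsStokesFamily.theta {A : SLC n} {Q : ℤ → SLC n} (hQ : IsStokesFamily n A Q) :
    IsStokesFamily n (conjReflection n (MulAut.conj (thetaTwist n Q) A))⁻¹ (thetaFamily Q) := by
  have hn : (n : ℝ) + 1 ≠ 0 := by positivity
  refine isStokesFamily_of_mem (fun m => ?_) (fun m => ?_) ?_
  · have h := conjReflection_mem_rootGroup
      (hQ.mem_rootGroup (2 * n + (if Odd n then 0 else 1) - m))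
    refine inv_mem ?_
    convert h using 2
    push_cast
    split_ifs <;> field_simp <;> ring
  · have h := hQ.add_two (2 * n + (if Odd n then 0 else 1) - (m + 2))
    rw [show 2 * (n : ℤ) + (if Odd n then 0 else 1) - (m + 2) + 2 =
      2 * n + (if Odd n then 0 else 1) - m by ring] at h
    rw [thetaFamily, thetaFamily, h, map_mul, map_mul, map_inv, conjReflection_coxeter]
    group
  -- The inverse in the second slot of `θ` pays off here: `ψ` turns the trailing `P⁻¹` back into
  -- `P`.
  · rw [← map_inv, hQ.conj_thetaTwist_inv, map_mul, map_mul, map_inv, map_inv, map_inv,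
      conjReflection_coxeter, inv_inv]
    rfl

theorem IsStokesFamily.commute_consecutiveProd {A X : SLC n} {Q : ℤ → SLC n}
    (hQ : IsStokesFamily n A Q) (hn : ¬ Odd n) (hX : Commute A X) :
    Commute (consecutiveProd Q (n + 1) (n + 1) *
      consecutiveProd Q (n + 1 + (n + 1)) (n + 1)) X := by
  have h1 := hQ.consecutiveProd_two_mul (n + 1) (n + 1)
  rw [coxeter_pow_card_of_even hn, mul_one, show (n : ℤ) + 1 + 1 = n + 2 by ring, ← hQ.2.2.2,
    two_mul, consecutiveProd_add, Nat.cast_succ] at h1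
  rw [h1]
  exact hX.pow_left _

theorem coxeter_half_pow_commute (hn : Odd n) (X : SLC n) :
    Commute (coxeter n ^ ((n + 1) / 2) * coxeter n ^ ((n + 1) / 2)) X := by
  rw [← pow_add, show (n + 1) / 2 + (n + 1) / 2 = n + 1 by obtain ⟨l, rfl⟩ := hn; omega]
  exact coxeter_pow_card_comm X

/-- `σ ∘ σ` conjugates by this product, which is the scalar `P^(n+1)` for `n` odd and `A^{-(n+1)}`
for `n` even. -/
theorem IsStokesFamily.commute_sigmaTwist {A X : SLC n} {Q : ℤ → SLC n}
    (hQ : IsStokesFamily n A Q) (hX : Commute A X) :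
    Commute (invTranspose n (sigmaTwist n (sigmaFamily Q)) * sigmaTwist n Q) X := by
  rw [sigmaTwist, sigmaTwist]
  split_ifs with hn
  · rw [map_pow, invTranspose_coxeter]
    exact coxeter_half_pow_commute hn X
  · have h : consecutiveProd (sigmaFamily Q) (n + 1) (n + 1) =
        invTranspose n (consecutiveProd Q (n + 1 + (n + 1)) (n + 1)) := by
      rw [← consecutiveProd_comp_add Q, ← map_consecutiveProd]
      rfl
    rw [h, map_inv, invTranspose_invTranspose, ← _root_.mul_inv_rev]
    exact (hQ.commute_consecutiveProd hn hX).inv_left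

theorem thetaTwist_mul_thetaTwist (Q : ℤ → SLC n) :
    conjReflection n (thetaTwist n (thetaFamily Q)) * thetaTwist n Q = 1 := by
  rw [thetaTwist, thetaTwist]
  split_ifs with hn
  -- The index `n` is the fixed point of `m ↦ 2n - m`, so the two twists are built from the same
  -- factor and cancel.
  · rw [thetaFamily, map_inv, conjReflection_conjReflection, if_pos hn,
      show 2 * (n : ℤ) + 0 - n = n by ring, inv_mul_cancel]
  · rw [map_one, mul_one]

/-- This compares the total twists of `θ ∘ σ` and `σ ∘ θ`. They differ by the scalar `P^{-(n+1)}`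
for `n` odd and by `A^(n+1)` for `n` even. -/
theorem IsStokesFamily.commute_sigmaTwist_thetaTwist {A X : SLC n} {Q : ℤ → SLC n}
    (hQ : IsStokesFamily n A Q) (hX : Commute A X) :
    Commute ((invTranspose n (thetaTwist n (sigmaFamily Q)) * sigmaTwist n Q)⁻¹ *
      (conjReflection n (sigmaTwist n (thetaFamily Q)) * thetaTwist n Q)) X := by
  simp only [thetaTwist, sigmaTwist]
  split_ifs with hn
  · have h2 : (n : ℤ) + 1 = 2 * ((n + 1) / 2 : ℕ) := by
      obtain ⟨l, rfl⟩ := hn; omega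
    rw [sigmaFamily, invTranspose_invTranspose, map_pow, conjReflection_coxeter, h2,
      hQ.add_two_mul]
    have h := (coxeter_half_pow_commute hn X).inv_left
    have hc := (coxeter_half_pow_commute hn (Q n)).inv_left
    rw [inv_pow]
    generalize coxeter n ^ ((n + 1) / 2) = p at h hc ⊢
    have e : (p * Q n * p⁻¹ * p)⁻¹ * (p⁻¹ * Q n) = (p * p)⁻¹ :=
      calc _ = (Q n)⁻¹ * ((p * p)⁻¹ * Q n) := by group
        _ = _ := by rw [hc.eq, inv_mul_cancel_left]
    rwa [e]
  · have h1 : consecutiveProd (thetaFamily Q) (n + 1) (n + 1) =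
        conjReflection n (consecutiveProd Q (n + 1 + (n + 1)) (n + 1))⁻¹ := by
      have e : thetaFamily Q =
          fun m => conjReflection n ((fun m => (Q (2 * n + 1 - m))⁻¹) m) := by
        funext m
        simp only [thetaFamily, if_neg hn, map_inv]
      -- The reflected window is `0, …, n`; a shift by the full period `2(n+1)` places it directly
      -- after the window that starts at `n + 1`.
      have h := consecutiveProd_comp_add Q (2 * (n + 1)) 0 (n + 1)
      simp only [hQ.add_two_mul_card] at h
      rw [e, map_consecutiveProd, consecutiveProd_inv_reflect,
        show 2 * (n : ℤ) + 1 - (n + 1) - (n + 1 : ℕ) + 1 = 0 by push_cast; ring, h,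
        show 0 + 2 * ((n : ℤ) + 1) = n + 1 + (n + 1) by ring]
    rw [h1, map_one, one_mul, mul_one, inv_inv, map_inv, conjReflection_conjReflection, inv_inv]
    exact hQ.commute_consecutiveProd hn hX

/-! ### The involutions on the universal centralizer -/

theorem conj_eq_of_commute {u v X : SLC n} (h : Commute (u⁻¹ * v) X) :
    MulAut.conj v X = MulAut.conj u X := by
  rw [MulAut.conj_apply, MulAut.conj_apply]
  have h' : u⁻¹ * v * X = X * (u⁻¹ * v) := h
  calc v * X * v⁻¹ = u * (u⁻¹ * v * X) * v⁻¹ := by group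
    _ = u * X * u⁻¹ := by rw [h']; group

theorem map_conj (φ : SLC n →* SLC n) (g X : SLC n) :
    φ (MulAut.conj g X) = MulAut.conj (φ g) (φ X) := by
  simp [MulAut.conj_apply]

theorem conj_conj (g h X : SLC n) :
    MulAut.conj g (MulAut.conj h X) = MulAut.conj (g * h) X := by
  rw [map_mul, MulAut.mul_apply]

theorem IsStokesFamily.sigmaMap_eq {A : SLC n} {Q : ℤ → SLC n} (hQ : IsStokesFamily n A Q)
    (B : SLC n) : sigmaMap n (B, A) = (invTranspose n (MulAut.conj (sigmaTwist n Q) B),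
      invTranspose n (MulAut.conj (sigmaTwist n Q) A)) := by
  rw [TTStarToda.sigmaMap_eq, hQ.stokesFactor_eq]

theorem IsStokesFamily.thetaMap_eq {A : SLC n} {Q : ℤ → SLC n} (hQ : IsStokesFamily n A Q)
    (B : SLC n) : thetaMap n (B, A) = (conjReflection n (MulAut.conj (thetaTwist n Q) B),
      (conjReflection n (MulAut.conj (thetaTwist n Q) A))⁻¹) := by
  rw [TTStarToda.thetaMap_eq, hQ.stokesFactor_eq]

theorem IsStokesFamily.sigma_sigma {A X : SLC n} {Q : ℤ → SLC n}
    (hQ : IsStokesFamily n A Q) (hX : Commute A X) :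
    invTranspose n (MulAut.conj (sigmaTwist n (sigmaFamily Q))
      (invTranspose n (MulAut.conj (sigmaTwist n Q) X))) = X := by
  rw [map_conj, invTranspose_invTranspose, conj_conj, MulAut.conj_apply,
    (hQ.commute_sigmaTwist hX).eq, mul_inv_cancel_right]

theorem theta_theta (Q : ℤ → SLC n) (X : SLC n) :
    conjReflection n (MulAut.conj (thetaTwist n (thetaFamily Q))
      (conjReflection n (MulAut.conj (thetaTwist n Q) X))) = X := by
  rw [map_conj, conjReflection_conjReflection, conj_conj, thetaTwist_mul_thetaTwist, map_one,
    MulAut.one_apply]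

theorem IsStokesFamily.sigma_theta {A X : SLC n} {Q : ℤ → SLC n}
    (hQ : IsStokesFamily n A Q) (hX : Commute A X) :
    invTranspose n (MulAut.conj (sigmaTwist n (thetaFamily Q))
      (conjReflection n (MulAut.conj (thetaTwist n Q) X))) =
    conjReflection n (MulAut.conj (thetaTwist n (sigmaFamily Q))
      (invTranspose n (MulAut.conj (sigmaTwist n Q) X))) := by
  have h1 : MulAut.conj (sigmaTwist n (thetaFamily Q))
      (conjReflection n (MulAut.conj (thetaTwist n Q) X)) =
      conjReflection n (MulAut.conj
        (conjReflection n (sigmaTwist n (thetaFamily Q)) * thetaTwist n Q) X) := by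
    rw [← conj_conj, map_conj _ (conjReflection n _), conjReflection_conjReflection]
  have h2 : MulAut.conj (thetaTwist n (sigmaFamily Q))
      (invTranspose n (MulAut.conj (sigmaTwist n Q) X)) =
      invTranspose n (MulAut.conj
        (invTranspose n (thetaTwist n (sigmaFamily Q)) * sigmaTwist n Q) X) := by
    rw [← conj_conj, map_conj _ (invTranspose n _), invTranspose_invTranspose]
  rw [h1, h2, invTranspose_conjReflection,
    conj_eq_of_commute (hQ.commute_sigmaTwist_thetaTwist hX)]

end

end TTStarToda

theorem mainTheorem7 (n : ℕ) :
    Set.MapsTo (TTStarToda.sigmaMap n)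
      (TTStarToda.univCentralizer n) (TTStarToda.univCentralizer n) ∧
    Set.MapsTo (TTStarToda.thetaMap n)
      (TTStarToda.univCentralizer n) (TTStarToda.univCentralizer n) ∧
    (∀ z ∈ TTStarToda.univCentralizer n,
      TTStarToda.sigmaMap n (TTStarToda.sigmaMap n z) = z) ∧
    (∀ z ∈ TTStarToda.univCentralizer n,
      TTStarToda.thetaMap n (TTStarToda.thetaMap n z) = z) ∧
    (∀ z ∈ TTStarToda.univCentralizer n,
      TTStarToda.sigmaMap n (TTStarToda.thetaMap n z) =
        TTStarToda.thetaMap n (TTStarToda.sigmaMap n z)) := by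
  refine ⟨?_, ?_, ?_, ?_, ?_⟩ <;> rintro ⟨B, A⟩ ⟨hA, hBA⟩ <;>
    have hQ := TTStarToda.isStokesFamily_stokesFactor hA <;>
    have hB : Commute A B := hBA.symm
  · rw [hQ.sigmaMap_eq]
    exact ⟨hQ.sigma.mem_crossSection,
      ((hB.symm.map (MulAut.conj _)).map (TTStarToda.invTranspose n)).eq⟩
  · rw [hQ.thetaMap_eq]
    exact ⟨hQ.theta.mem_crossSection,
      ((hB.symm.map (MulAut.conj _)).map (TTStarToda.conjReflection n)).inv_right.eq⟩
  · rw [hQ.sigmaMap_eq, hQ.sigma.sigmaMap_eq, hQ.sigma_sigma hB, hQ.sigma_sigma (Commute.refl A)]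
  · rw [hQ.thetaMap_eq, hQ.theta.thetaMap_eq, map_inv, map_inv, inv_inv,
      TTStarToda.theta_theta, TTStarToda.theta_theta]
  -- The inverse in the second slot passes through the homomorphisms, so both slots reduce to
  -- `sigma_theta`, with `X = B` and `X = A`.
  · rw [hQ.thetaMap_eq, hQ.theta.sigmaMap_eq, hQ.sigmaMap_eq, hQ.sigma.thetaMap_eq, map_inv,
      map_inv, hQ.sigma_theta hB, hQ.sigma_theta (Commute.refl A)]
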